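/- Throughout, $q$ denotes a power of an odd prime, $\mathbb{F}_q$ is the field with $q$ elements, and for $x\in\mathbb{F}_q^d$ we write $\|x\|=x_1^2+\cdots+x_d^2\in\mathbb{F}_q$. For $E\subset\mathbb{F}_q^d$ and $t\in\mathbb{F}_q$, let $\mathcal{G}_t(E)$ be the graph with vertex set $E$ in which two distinct points $x,y$ are adjacent if and only if $\|x-y\|=t$. For a finite graph $G$, let $\Delta_G(E)$ be the set of all $t\in\mathbb{F}_q$ such that $\mathcal{G}_t(E)$ contains a (not necessarily induced) subgraph isomorphic to $G$. Let $C_n$ denote the cycle on $n$ vertices. For each integer $k\ge 2$ there exists a constant $c_k>0$, depending only on $k$, such that the following holds for every power $q$ of an odd prime, every $d$, and every $E\subset\mathbb{F}_q^d$ with $|E|>c_k\,q^{\frac{d+1}{2}}$: (a) If $d=2$ and $k\ge 3$, then $\Delta_{C_{2k}}(E)\supseteq\mathbb{F}_q\setminus\{0\}$. (b) If $d\ge 3$, then $\Delta_{C_{2k}}(E)\supseteq\mathbb{F}_q\setminus\{0\}$. -/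

import Mathlib

/-- The length `‖x‖ = x₁² + ⋯ + x_d²` of a vector `x ∈ F^d`; it is an element of the field `F`. -/
def ffLength {F : Type*} [Field F] {d : ℕ} (x : Fin d → F) : F :=
  ∑ i, x i ^ 2

/-- The `t`-distance graph of `E ⊆ F^d`: the vertices are the points of `E`, and two distinct
points are adjacent when `‖x - y‖ = t`. For `t ≠ 0`, points with `‖x - y‖ = t` are automatically
distinct; for `t = 0`, the condition `x ≠ y` only removes loops. -/
def ffDistanceGraph {F : Type*} [Field F] {d : ℕ} (E : Set (Fin d → F)) (t : F) :
    SimpleGraph E where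
  Adj x y := x ≠ y ∧ ffLength ((x : Fin d → F) - (y : Fin d → F)) = t
  symm := ⟨fun x y h => ⟨h.1.symm, by
    rw [← h.2]
    exact Finset.sum_congr rfl fun i _ => by simp only [Pi.sub_apply]; ring⟩⟩
  loopless := ⟨fun _ h => h.1 rfl⟩

/-- The `G`-distance set of `E`: all `t ∈ F` such that the `t`-distance graph of `E` contains a
(not necessarily induced) subgraph isomorphic to `G`. -/
def ffGraphDistanceSet {V : Type*} (G : SimpleGraph V) {F : Type*} [Field F] {d : ℕ}
    (E : Set (Fin d → F)) : Set F :=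
  {t : F | SimpleGraph.IsContained G (ffDistanceGraph E t)}

/-! A closed-walk criterion for even cycles is combined with the Iosevich–Rudnev estimate for pairs
at distance t.

Graph side: let A be the adjacency matrix of a graph on n vertices with maximum degree at most D and
average degree at least d. Then tr A^(2k) counts closed walks of length 2k and is at least d^(2k).
Without a C_{2k}, every such walk repeats a vertex. Log-convexity of the even diagonal entries
bounds the walks with a prescribed repetition by D tr A^(2k-2), and (tr A^(2k-2))^k ≤ n (tr
A^(2k))^(k-1). Hence d^(2k) ≤ (4k²D)^k n; violating this forces the cycle
(`SimpleGraph.cycleGraph_isContained_of_degree`).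

Distance side: by `abs_card_pairs_sub_le`, E has |E|²/q ordered pairs at distance t ≠ 0, up to
2q^((d-1)/2)|E|. Deleting points of large degree leaves at least half of E, with maximum and average
degree both of order |E|/q (`exists_subset_degree_bounds`). The criterion then asks that |E|^(k-1)
exceed a constant times q^k. This follows from |E| > c q^((d+1)/2) when 2k ≤ (d+1)(k-1), which holds
for d = 2, k ≥ 3 and for d ≥ 3, k ≥ 2.

Exponential sums: the Fourier coefficients of a sphere are a power of a Gauss sum times a
Kloosterman or Salié sum. Salié sums are evaluated directly. For Kloosterman sums K, Stepanov's
method over fields of square order Q gives |K| ≤ 14p√Q. The relation K_L = 2q - K² for a quadratic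
extension L of a field of q elements amplifies any excess over 2√q up a tower, so the constant 14p
improves to 2 (`norm_kloosterman_le`). -/

/-! ### Log-convex sequences. -/

section LogConvex

/-- In a nonnegative log-convex sequence, spreading two indices apart by one increases the
product. -/
theorem logConvex_succ_mul_le {s : ℕ → ℝ} (h0 : ∀ i, 0 ≤ s i)
    (h : ∀ i, s (i + 1) ^ 2 ≤ s i * s (i + 2)) (a m : ℕ) :
    s (a + 1) * s (a + m) ≤ s a * s (a + m + 1) := by
  induction m with
  | zero => simp [mul_comm]
  | succ m ih =>
    rcases (h0 (a + m + 1)).eq_or_lt with hz | hz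
    · rw [← add_assoc, ← hz, mul_zero]
      exact mul_nonneg (h0 _) (h0 _)
    · have hpos : 0 < s (a + m) := by
        rcases (h0 (a + m)).eq_or_lt with h1 | h1
        · have := h (a + m)
          rw [← h1] at this
          nlinarith
        · exact h1
      refine le_of_mul_le_mul_right ?_ hpos
      have h2 := h (a + m)
      rw [← add_assoc]
      calc s (a + 1) * s (a + m + 1) * s (a + m)
          = s (a + 1) * s (a + m) * s (a + m + 1) := by ring
        _ ≤ s a * s (a + m + 1) * s (a + m + 1) := mul_le_mul_of_nonneg_right ih hz.le
        _ = s a * s (a + m + 1) ^ 2 := by ring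
        _ ≤ s a * (s (a + m) * s (a + m + 2)) := mul_le_mul_of_nonneg_left h2 (h0 a)
        _ = s a * s (a + m + 1 + 1) * s (a + m) := by ring_nf

theorem logConvex_mul_le {s : ℕ → ℝ} (h0 : ∀ i, 0 ≤ s i)
    (h : ∀ i, s (i + 1) ^ 2 ≤ s i * s (i + 2)) (a m n : ℕ) :
    s (a + m) * s (a + n) ≤ s a * s (a + m + n) := by
  induction m generalizing a n with
  | zero => simp
  | succ m ih =>
    cases n with
    | zero => simp [mul_comm]
    | succ n =>
      calc s (a + (m + 1)) * s (a + (n + 1)) = s (a + 1 + m) * s (a + 1 + n) := by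
            congr 2 <;> ring
        _ ≤ s (a + 1) * s (a + 1 + m + n) := ih _ _
        _ = s (a + 1) * s (a + (m + n + 1)) := by congr 2; ring
        _ ≤ s a * s (a + (m + n + 1) + 1) := logConvex_succ_mul_le h0 h _ _
        _ = s a * s (a + (m + 1) + (n + 1)) := by congr 2; ring

/-- The index `j` is the mean of `0` and `j + 1` with weights 1/(j+1) and j/(j+1); this is the
convexity of log s there, with roots cleared. -/
theorem logConvex_pow_succ_le {s : ℕ → ℝ} (h0 : ∀ i, 0 ≤ s i)
    (h : ∀ i, s (i + 1) ^ 2 ≤ s i * s (i + 2)) (j : ℕ) :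
    s j ^ (j + 1) ≤ s 0 * s (j + 1) ^ j := by
  induction j with
  | zero => simp
  | succ j ih =>
    rcases (h0 (j + 1)).eq_or_lt with hz | hz
    · rw [← hz, zero_pow (by omega)]
      exact mul_nonneg (h0 _) (pow_nonneg (h0 _) _)
    · refine le_of_mul_le_mul_right ?_ (pow_pos hz j)
      calc s (j + 1) ^ (j + 1 + 1) * s (j + 1) ^ j = (s (j + 1) ^ 2) ^ (j + 1) := by ring
        _ ≤ (s j * s (j + 2)) ^ (j + 1) := pow_le_pow_left₀ (by positivity) (h j) _
        _ = s j ^ (j + 1) * s (j + 2) ^ (j + 1) := by ring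
        _ ≤ s 0 * s (j + 1) ^ j * s (j + 2) ^ (j + 1) :=
            mul_le_mul_of_nonneg_right ih (pow_nonneg (h0 _) _)
        _ = s 0 * s (j + 1 + 1) ^ (j + 1) * s (j + 1) ^ j := by ring

theorem logConvex_one_pow_le {s : ℕ → ℝ} (h0 : ∀ i, 0 ≤ s i)
    (h : ∀ i, s (i + 1) ^ 2 ≤ s i * s (i + 2)) (j : ℕ) :
    s 1 ^ (j + 1) ≤ s 0 ^ j * s (j + 1) := by
  induction j with
  | zero => simp
  | succ j ih =>
    have h1 := logConvex_succ_mul_le h0 h 0 (j + 1)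
    simp only [zero_add] at h1
    calc s 1 ^ (j + 1 + 1) = s 1 ^ (j + 1) * s 1 := by ring
      _ ≤ s 0 ^ j * s (j + 1) * s 1 := mul_le_mul_of_nonneg_right ih (h0 _)
      _ = s 0 ^ j * (s 1 * s (j + 1)) := by ring
      _ ≤ s 0 ^ j * (s 0 * s (j + 1 + 1)) := mul_le_mul_of_nonneg_left h1 (pow_nonneg (h0 _) _)
      _ = s 0 ^ (j + 1) * s (j + 1 + 1) := by ring

end LogConvex

/-! ### Diagonal entries and traces of powers of a symmetric matrix. -/

section SymmetricPowers

variable {V : Type*} [Fintype V] [DecidableEq V] {A : Matrix V V ℝ}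

open Matrix

theorem Matrix.IsSymm.pow_add_diag (hA : A.IsSymm) (i j : ℕ) (v : V) :
    (A ^ (i + j)) v v = ∑ w, (A ^ i) v w * (A ^ j) v w := by
  rw [pow_add, Matrix.mul_apply]
  refine Finset.sum_congr rfl fun w _ => ?_
  rw [(hA.pow j).apply]

/-- Cauchy–Schwarz for row `v` of `A ^ i` and of `A ^ j`. It makes the even diagonal entries
log-convex and controls the odd ones, whose sign is unknown. -/
theorem Matrix.IsSymm.sq_diag_le (hA : A.IsSymm) (i j : ℕ) (v : V) :
    (A ^ (i + j)) v v ^ 2 ≤ (A ^ (2 * i)) v v * (A ^ (2 * j)) v v := by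
  rw [hA.pow_add_diag, two_mul, two_mul, hA.pow_add_diag i i, hA.pow_add_diag j j]
  simpa [sq] using Finset.sum_mul_sq_le_sq_mul_sq Finset.univ (fun w => (A ^ i) v w)
    (fun w => (A ^ j) v w)

theorem Matrix.IsSymm.even_diag_nonneg (hA : A.IsSymm) (i : ℕ) (v : V) :
    0 ≤ (A ^ (2 * i)) v v := by
  rw [two_mul, hA.pow_add_diag]
  exact Finset.sum_nonneg fun w _ => mul_self_nonneg _

/-- For a symmetric matrix with zero diagonal, the product of two diagonal entries of powers with
fixed total exponent is largest for the extreme exponents. -/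
theorem Matrix.IsSymm.diag_mul_diag_le (hA : A.IsSymm) (hd : ∀ v, A v v = 0) {k a b : ℕ}
    (ha : 1 ≤ a) (hb : 1 ≤ b) (hab : a + b = 2 * k) (v : V) :
    (A ^ a) v v * (A ^ b) v v ≤ (A ^ 2) v v * (A ^ (2 * (k - 1))) v v := by
  set s : ℕ → ℝ := fun i => (A ^ (2 * i)) v v with hs
  have h0 : ∀ i, 0 ≤ s i := fun i => hA.even_diag_nonneg i v
  have hlc : ∀ i, s (i + 1) ^ 2 ≤ s i * s (i + 2) := by
    intro i
    have := hA.sq_diag_le i (i + 2) v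
    simpa [hs, show i + (i + 2) = 2 * (i + 1) by ring] using this
  have key : ∀ i j, i + j + 2 = k → s (1 + i) * s (1 + j) ≤ s 1 * s (k - 1) := by
    intro i j hij
    have := logConvex_mul_le h0 hlc 1 i j
    rwa [show 1 + i + j = k - 1 by omega] at this
  have hR : (A ^ 2) v v * (A ^ (2 * (k - 1))) v v = s 1 * s (k - 1) := by simp [hs]
  have hRn : 0 ≤ s 1 * s (k - 1) := mul_nonneg (h0 _) (h0 _)
  rw [hR]
  rcases Nat.even_or_odd' a with ⟨i, rfl | rfl⟩
  · obtain ⟨j, rfl⟩ : ∃ j, b = 2 * j := ⟨k - i, by omega⟩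
    obtain ⟨i, rfl⟩ : ∃ i', i = 1 + i' := ⟨i - 1, by omega⟩
    obtain ⟨j, rfl⟩ : ∃ j', j = 1 + j' := ⟨j - 1, by omega⟩
    exact key i j (by omega)
  -- Odd exponents: an exponent 1 gives zero by the vanishing diagonal. Otherwise each odd entry is
  -- bounded by its two even neighbours, and the four factors are regrouped crosswise into two
  -- products with the right total exponent.
  · obtain ⟨j, rfl⟩ : ∃ j, b = 2 * j + 1 := ⟨k - i - 1, by omega⟩
    rcases Nat.eq_zero_or_pos i with rfl | hi
    · simpa [hd] using hRn
    rcases Nat.eq_zero_or_pos j with rfl | hj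
    · simpa [hd] using hRn
    obtain ⟨i, rfl⟩ : ∃ i', i = 1 + i' := ⟨i - 1, by omega⟩
    obtain ⟨j, rfl⟩ : ∃ j', j = 1 + j' := ⟨j - 1, by omega⟩
    have h1 := hA.sq_diag_le (1 + i) (1 + (i + 1)) v
    have h2 := hA.sq_diag_le (1 + (j + 1)) (1 + j) v
    rw [show 1 + i + (1 + (i + 1)) = 2 * (1 + i) + 1 by ring] at h1
    rw [show 1 + (j + 1) + (1 + j) = 2 * (1 + j) + 1 by ring] at h2
    refine abs_le_of_sq_le_sq' ?_ hRn |>.2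
    calc ((A ^ (2 * (1 + i) + 1)) v v * (A ^ (2 * (1 + j) + 1)) v v) ^ 2
        = (A ^ (2 * (1 + i) + 1)) v v ^ 2 * (A ^ (2 * (1 + j) + 1)) v v ^ 2 := mul_pow _ _ _
      _ ≤ (s (1 + i) * s (1 + (i + 1))) * (s (1 + (j + 1)) * s (1 + j)) :=
          mul_le_mul h1 h2 (sq_nonneg _) (mul_nonneg (h0 _) (h0 _))
      _ = (s (1 + i) * s (1 + (j + 1))) * (s (1 + (i + 1)) * s (1 + j)) := by ring
      _ ≤ (s 1 * s (k - 1)) * (s 1 * s (k - 1)) :=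
          mul_le_mul (key _ _ (by omega)) (key _ _ (by omega)) (mul_nonneg (h0 _) (h0 _)) hRn
      _ = (s 1 * s (k - 1)) ^ 2 := by ring

/-- The power-mean inequality for the squared eigenvalues, obtained from log-convexity of the traces
without diagonalising. -/
theorem Matrix.IsSymm.trace_pow_le (hA : A.IsSymm) (j : ℕ) :
    (A ^ (2 * j)).trace ^ (j + 1) ≤ Fintype.card V * (A ^ (2 * (j + 1))).trace ^ j := by
  have := logConvex_pow_succ_le (s := fun i => (A ^ (2 * i)).trace)
    (fun i => Finset.sum_nonneg fun v _ => hA.even_diag_nonneg i v) (fun i => ?_) j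
  · simpa using this
  · simp only [Matrix.trace, Matrix.diag_apply]
    refine (Finset.sum_sq_le_sum_mul_sum_of_sq_le_mul Finset.univ
      (fun v _ => hA.even_diag_nonneg i v) (fun v _ => hA.even_diag_nonneg (i + 2) v)
      fun v _ => ?_)
    have := hA.sq_diag_le i (i + 2) v
    simpa [show i + (i + 2) = 2 * (i + 1) by ring] using this

theorem Matrix.IsSymm.dotProduct_pow_add (hA : A.IsSymm) (x : V → ℝ) (i j : ℕ) :
    x ⬝ᵥ (A ^ (i + j) *ᵥ x) = (A ^ i *ᵥ x) ⬝ᵥ (A ^ j *ᵥ x) := by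
  rw [pow_add, ← Matrix.mulVec_mulVec, Matrix.dotProduct_mulVec]
  congr 1
  rw [← Matrix.mulVec_transpose, (hA.pow i).eq]

/-- The trace of an even power dominates the corresponding power of the mean row sum. -/
theorem Matrix.IsSymm.sum_pow_le_trace (hA : A.IsSymm) (j : ℕ) :
    (∑ u, ∑ v, A u v) ^ (2 * (j + 1)) ≤
      (Fintype.card V : ℝ) ^ (2 * (j + 1)) * (A ^ (2 * (j + 1))).trace := by
  set n : ℝ := (Fintype.card V : ℝ)
  set x : V → ℝ := fun _ => 1 with hx
  -- The squared norms of `A ^ i` applied to the all-ones vector are log-convex. They start at `n`,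
  -- the next is at least (sum of entries)²/n, and the norm at `j + 1` is at most `n` times the
  -- trace.
  set s : ℕ → ℝ := fun i => (A ^ i *ᵥ x) ⬝ᵥ (A ^ i *ᵥ x) with hs
  have hn : 0 ≤ n := Nat.cast_nonneg _
  have h0 : ∀ i, 0 ≤ s i := fun i => by
    simp only [hs, dotProduct]
    exact Finset.sum_nonneg fun v _ => mul_self_nonneg _
  have hlc : ∀ i, s (i + 1) ^ 2 ≤ s i * s (i + 2) := by
    intro i
    have h1 : s (i + 1) = (A ^ i *ᵥ x) ⬝ᵥ (A ^ (i + 2) *ᵥ x) := by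
      simp only [hs]
      rw [← hA.dotProduct_pow_add, ← hA.dotProduct_pow_add]
      congr 3
      ring
    rw [h1]
    simpa only [hs, dotProduct, sq] using Finset.sum_mul_sq_le_sq_mul_sq Finset.univ
      (A ^ i *ᵥ x) (A ^ (i + 2) *ᵥ x)
  have hs0 : s 0 = n := by simp [hs, hx, dotProduct, n]
  have hs1 : (∑ u, ∑ v, A u v) ^ 2 ≤ n * s 1 := by
    have := sq_sum_le_card_mul_sum_sq (s := Finset.univ) (f := fun u => ∑ v, A u v)
    simpa [hs, hx, dotProduct, mulVec, sq, n] using this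
  have hsk : s (j + 1) ≤ n * (A ^ (2 * (j + 1))).trace := by
    simp only [hs, Matrix.trace, Matrix.diag_apply, two_mul, hA.pow_add_diag, Finset.mul_sum]
    simp only [dotProduct]
    refine Finset.sum_le_sum fun u _ => ?_
    have := sq_sum_le_card_mul_sum_sq (s := Finset.univ) (f := fun v => (A ^ (j + 1)) u v)
    simpa [hx, dotProduct, mulVec, sq, n, Finset.mul_sum] using this
  calc (∑ u, ∑ v, A u v) ^ (2 * (j + 1)) = ((∑ u, ∑ v, A u v) ^ 2) ^ (j + 1) := by rw [pow_mul]
    _ ≤ (n * s 1) ^ (j + 1) := pow_le_pow_left₀ (sq_nonneg _) hs1 _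
    _ = n ^ (j + 1) * s 1 ^ (j + 1) := mul_pow _ _ _
    _ ≤ n ^ (j + 1) * (s 0 ^ j * s (j + 1)) :=
        mul_le_mul_of_nonneg_left (logConvex_one_pow_le h0 hlc j) (by positivity)
    _ ≤ n ^ (j + 1) * (n ^ j * (n * (A ^ (2 * (j + 1))).trace)) := by
        rw [hs0]
        gcongr
    _ = n ^ (2 * (j + 1)) * (A ^ (2 * (j + 1))).trace := by ring

end SymmetricPowers

/-! ### Closed walks and even cycles in graphs. -/

namespace SimpleGraph

variable {V : Type*} {G : SimpleGraph V}

theorem Walk.exists_append_of_getVert_eq {u v : V} (p : G.Walk u v) {i j : ℕ} (hij : i ≤ j)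
    (hj : j ≤ p.length) (h : p.getVert i = p.getVert j) :
    ∃ (w : V) (p₁ : G.Walk u w) (p₂ : G.Walk w w) (p₃ : G.Walk w v),
      p = p₁.append (p₂.append p₃) ∧ p₁.length = i ∧ p₂.length = j - i ∧
        p₃.length = p.length - j := by
  have h1 : (p.drop i).getVert (j - i) = p.getVert i := by
    rw [Walk.drop_getVert, h]
    congr 1
    omega
  refine ⟨p.getVert i, p.take i, ((p.drop i).take (j - i)).copy rfl h1,
    ((p.drop i).drop (j - i)).copy h1 rfl, ?_, ?_, ?_, ?_⟩
  · simp only [Walk.append_copy_copy, Walk.copy_rfl_rfl, Walk.append_take_drop_eq]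
  · rw [Walk.take_length]; omega
  · rw [Walk.length_copy, Walk.take_length, Walk.drop_length]; omega
  · rw [Walk.length_copy, Walk.drop_length, Walk.drop_length]; omega

/-- A closed walk of length at least three is a cycle once its tail is a path. Index 0 is excluded
because its vertex always recurs at the end. -/
theorem Walk.exists_getVert_eq_of_not_isCycle {v : V} (p : G.Walk v v) (h3 : 3 ≤ p.length)
    (hp : ¬ p.IsCycle) :
    ∃ i j, 1 ≤ i ∧ i < j ∧ j ≤ p.length ∧ p.getVert i = p.getVert j := by
  by_contra! hne
  refine hp (Walk.isCycle_iff_isPath_tail_and_le_length.mpr ⟨?_, h3⟩)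
  rw [Walk.isPath_iff_injective_get_support]
  have hlen : p.tail.support.length = p.length := by
    have hn : ¬ p.Nil := by
      intro hn
      rw [← Walk.length_eq_zero_iff] at hn
      omega
    rw [Walk.length_support, Walk.length_tail_add_one hn]
  have key : ∀ a b : Fin p.tail.support.length, a < b →
      p.tail.support.get a ≠ p.tail.support.get b := by
    intro a b hab
    simp only [List.get_eq_getElem, Walk.support_getElem_eq_getVert, Walk.getVert_tail]
    exact hne _ _ (by omega) (by have := hab; simp only [Fin.lt_def] at this; omega)
      (by have := b.2; omega)
  intro a b hab
  rcases lt_trichotomy a b with h | h | h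
  · exact absurd hab (key a b h)
  · exact h
  · exact absurd hab.symm (key b a h)

section Count

variable [Fintype V] [DecidableEq V] [DecidableRel G.Adj]

theorem adjMatrix_pow_apply_eq_card_finsetWalkLength (n : ℕ) (u v : V) :
    (G.adjMatrix ℝ ^ n) u v = (G.finsetWalkLength n u v).card := by
  rw [adjMatrix_pow_apply_eq_card_walk, card_set_walk_length_eq]

/-- Cutting at times `i` and `j` yields an arc to the repeated vertex `w`, a closed walk at `w` and
an arc back; these three pieces determine the walk. -/
theorem card_closedWalk_getVert_eq_le {N i j : ℕ} (hij : i < j) (hj : j ≤ N) (v : V) :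
    (((G.finsetWalkLength N v v).filter fun p => p.getVert i = p.getVert j).card : ℝ) ≤
      ∑ w, (G.adjMatrix ℝ ^ i) v w * ((G.adjMatrix ℝ ^ (j - i)) w w *
        (G.adjMatrix ℝ ^ (N - j)) w v) := by
  simp only [adjMatrix_pow_apply_eq_card_finsetWalkLength]
  have hsub : ((G.finsetWalkLength N v v).filter fun p => p.getVert i = p.getVert j) ⊆
      Finset.univ.biUnion fun w : V =>
        ((G.finsetWalkLength i v w) ×ˢ
          ((G.finsetWalkLength (j - i) w w) ×ˢ (G.finsetWalkLength (N - j) w v))).image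
            fun q => q.1.append (q.2.1.append q.2.2) := by
    intro p hp
    rw [Finset.mem_filter, mem_finsetWalkLength_iff] at hp
    obtain ⟨w, p₁, p₂, p₃, h, h1, h2, h3⟩ :=
      p.exists_append_of_getVert_eq hij.le (hj.trans_eq hp.1.symm) hp.2
    simp only [Finset.mem_biUnion, Finset.mem_univ, true_and, Finset.mem_image,
      Finset.mem_product, mem_finsetWalkLength_iff, Prod.exists]
    exact ⟨w, p₁, p₂, p₃, ⟨h1, h2, by rw [h3, hp.1]⟩, h.symm⟩
  have hcard := (Finset.card_le_card hsub).trans Finset.card_biUnion_le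
  have hcard2 : ((G.finsetWalkLength N v v).filter fun p => p.getVert i = p.getVert j).card ≤
      ∑ w, (G.finsetWalkLength i v w).card *
        ((G.finsetWalkLength (j - i) w w).card * (G.finsetWalkLength (N - j) w v).card) := by
    refine hcard.trans (Finset.sum_le_sum fun w _ => Finset.card_image_le.trans ?_)
    rw [Finset.card_product, Finset.card_product]
  exact_mod_cast hcard2

/-- The closed walks of length `2k` with a prescribed coincidence of vertices are bounded by the
maximum degree times the number of closed walks of length `2k - 2`. -/
theorem sum_card_closedWalk_getVert_eq_le {k i j : ℕ} {D : ℝ}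
    (hD : ∀ v, (G.degree v : ℝ) ≤ D) (hi : 1 ≤ i) (hij : i < j) (hj : j ≤ 2 * k) :
    ∑ v, (((G.finsetWalkLength (2 * k) v v).filter fun p => p.getVert i = p.getVert j).card : ℝ) ≤
      D * (G.adjMatrix ℝ ^ (2 * (k - 1))).trace := by
  have hA : (G.adjMatrix ℝ).IsSymm := isSymm_adjMatrix G
  calc _ ≤ ∑ v, ∑ w, (G.adjMatrix ℝ ^ i) v w * ((G.adjMatrix ℝ ^ (j - i)) w w *
        (G.adjMatrix ℝ ^ (2 * k - j)) w v) :=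
        Finset.sum_le_sum fun v _ => card_closedWalk_getVert_eq_le hij hj v
    -- Summing over the base point `v` glues the two outer arcs into a second closed walk at `w`.
    _ = ∑ w, (G.adjMatrix ℝ ^ (j - i)) w w * (G.adjMatrix ℝ ^ (2 * k - j + i)) w w := by
        rw [Finset.sum_comm]
        refine Finset.sum_congr rfl fun w _ => ?_
        rw [pow_add, Matrix.mul_apply, Finset.mul_sum]
        exact Finset.sum_congr rfl fun v _ => by ring
    _ ≤ ∑ w, (G.adjMatrix ℝ ^ 2) w w * (G.adjMatrix ℝ ^ (2 * (k - 1))) w w :=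
        Finset.sum_le_sum fun w _ => hA.diag_mul_diag_le (by simp) (by omega) (by omega)
          (by omega) w
    _ ≤ ∑ w, D * (G.adjMatrix ℝ ^ (2 * (k - 1))) w w := by
        refine Finset.sum_le_sum fun w _ =>
          mul_le_mul_of_nonneg_right ?_ (hA.even_diag_nonneg _ _)
        rw [sq, adjMatrix_mul_self_apply_self]
        exact hD w
    _ = _ := by rw [Matrix.trace, Finset.mul_sum]; rfl

/-- A graph whose maximum degree `D` is small compared with the square of its average degree
contains the even cycle `C_{2k}`. -/
theorem cycleGraph_isContained_of_degree {k : ℕ} (hk : 2 ≤ k) {D d : ℝ} (hd : 0 ≤ d)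
    (hV : 0 < Fintype.card V)
    (hD : ∀ v, (G.degree v : ℝ) ≤ D) (havg : d * Fintype.card V ≤ ∑ v, (G.degree v : ℝ))
    (h : (4 * k ^ 2 * D) ^ k * Fintype.card V < d ^ (2 * k)) :
    cycleGraph (2 * k) ⊑ G := by
  by_contra hG
  rw [cycleGraph_isContained_iff (by omega)] at hG
  push Not at hG
  have hA : (G.adjMatrix ℝ).IsSymm := isSymm_adjMatrix G
  set n : ℝ := (Fintype.card V : ℝ) with hn
  have hn0 : 0 < n := Nat.cast_pos.mpr hV
  set T := (G.adjMatrix ℝ ^ (2 * k)).trace with hT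
  set T' := (G.adjMatrix ℝ ^ (2 * (k - 1))).trace with hT'
  have hD0 : 0 ≤ D := by
    obtain ⟨v⟩ := Fintype.card_pos_iff.mp hV
    exact (Nat.cast_nonneg _).trans (hD v)
  have hT0 : 0 ≤ T := Finset.sum_nonneg fun v _ => hA.even_diag_nonneg k v
  have hT'0 : 0 ≤ T' := Finset.sum_nonneg fun v _ => hA.even_diag_nonneg (k - 1) v
  set I := ((Finset.range (2 * k + 1)) ×ˢ (Finset.range (2 * k + 1))).filter
    fun q => 1 ≤ q.1 ∧ q.1 < q.2 with hI
  have hIcard : (I.card : ℝ) ≤ 4 * k ^ 2 := by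
    have : I ⊆ (Finset.Icc 1 (2 * k)) ×ˢ (Finset.Icc 1 (2 * k)) := by
      intro q hq
      simp only [hI, Finset.mem_filter, Finset.mem_product, Finset.mem_range] at hq
      simp only [Finset.mem_product, Finset.mem_Icc]
      omega
    have h2 := Finset.card_le_card this
    rw [Finset.card_product, Nat.card_Icc] at h2
    have h3 : I.card ≤ (2 * k) * (2 * k) := by simpa using h2
    calc (I.card : ℝ) ≤ ((2 * k) * (2 * k) : ℕ) := by exact_mod_cast h3
      _ = 4 * k ^ 2 := by push_cast; ring
  -- Without a cycle of length `2 * k`, every closed walk of that length has a coincidence indexed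
  -- by `I`; this is the union bound over `I`.
  have hTle : T ≤ 4 * k ^ 2 * D * T' := by
    have h1 : ∀ v, (G.adjMatrix ℝ ^ (2 * k)) v v ≤ ∑ q ∈ I,
        (((G.finsetWalkLength (2 * k) v v).filter
          fun p => p.getVert q.1 = p.getVert q.2).card : ℝ) := by
      intro v
      rw [adjMatrix_pow_apply_eq_card_finsetWalkLength]
      have hsub : G.finsetWalkLength (2 * k) v v ⊆ I.biUnion fun q =>
          (G.finsetWalkLength (2 * k) v v).filter fun p => p.getVert q.1 = p.getVert q.2 := by
        intro p hp
        have hlen := mem_finsetWalkLength_iff.mp hp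
        obtain ⟨i, j, hi, hij, hj, he⟩ := p.exists_getVert_eq_of_not_isCycle (by omega)
          (fun hc => hG v p hc hlen)
        rw [Finset.mem_biUnion]
        refine ⟨(i, j), ?_, Finset.mem_filter.mpr ⟨hp, he⟩⟩
        simp only [hI, Finset.mem_filter, Finset.mem_product, Finset.mem_range]
        omega
      exact_mod_cast (Finset.card_le_card hsub).trans Finset.card_biUnion_le
    calc T ≤ ∑ v, ∑ q ∈ I, (((G.finsetWalkLength (2 * k) v v).filter
          fun p => p.getVert q.1 = p.getVert q.2).card : ℝ) := Finset.sum_le_sum fun v _ => h1 v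
      _ = ∑ q ∈ I, ∑ v, (((G.finsetWalkLength (2 * k) v v).filter
          fun p => p.getVert q.1 = p.getVert q.2).card : ℝ) := Finset.sum_comm
      _ ≤ ∑ q ∈ I, D * T' := by
          refine Finset.sum_le_sum fun q hq => ?_
          simp only [hI, Finset.mem_filter, Finset.mem_product, Finset.mem_range] at hq
          exact sum_card_closedWalk_getVert_eq_le hD hq.2.1 hq.2.2 (by omega)
      _ = I.card * (D * T') := by rw [Finset.sum_const, nsmul_eq_mul]
      _ ≤ 4 * k ^ 2 * (D * T') := mul_le_mul_of_nonneg_right hIcard (mul_nonneg hD0 hT'0)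
      _ = _ := by ring
  have hsum : (∑ u, ∑ v, G.adjMatrix ℝ u v) = ∑ v, (G.degree v : ℝ) := by
    refine Finset.sum_congr rfl fun u _ => ?_
    simp [adjMatrix_apply, ← card_neighborFinset_eq_degree,
      neighborFinset_eq_filter]
  obtain ⟨l, rfl⟩ : ∃ l, k = l + 1 := ⟨k - 1, by omega⟩
  have hlow : d ^ (2 * (l + 1)) ≤ T := by
    have h1 := hA.sum_pow_le_trace l
    rw [hsum] at h1
    have h2 : (d * n) ^ (2 * (l + 1)) ≤ n ^ (2 * (l + 1)) * T :=
      (pow_le_pow_left₀ (by positivity) havg _).trans h1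
    rw [mul_pow, mul_comm] at h2
    exact le_of_mul_le_mul_left h2 (by positivity)
  have htr : T' ^ (l + 1) ≤ n * T ^ l := hA.trace_pow_le l
  have hTpos : 0 < T := lt_of_lt_of_le (lt_of_le_of_lt (by positivity) h) hlow
  -- Eliminating `T'` and cancelling `T ^ l` bounds `T` by the left side of `h`, contradicting
  -- `hlow`.
  have hfin : T * T ^ l ≤ (4 * (l + 1 : ℕ) ^ 2 * D) ^ (l + 1) * n * T ^ l := by
    calc T * T ^ l = T ^ (l + 1) := by ring
      _ ≤ (4 * (l + 1 : ℕ) ^ 2 * D * T') ^ (l + 1) := pow_le_pow_left₀ hT0 hTle _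
      _ = (4 * (l + 1 : ℕ) ^ 2 * D) ^ (l + 1) * T' ^ (l + 1) := mul_pow _ _ _
      _ ≤ (4 * (l + 1 : ℕ) ^ 2 * D) ^ (l + 1) * (n * T ^ l) :=
          mul_le_mul_of_nonneg_left htr (by positivity)
      _ = _ := by ring
  have := le_of_mul_le_mul_right hfin (pow_pos hTpos l)
  linarith

end Count

end SimpleGraph

/-! ### Stepanov's method over a field with `P ^ 2` elements. -/

section Stepanov

open Polynomial

/-- If `U` were nonzero, an irreducible factor of `h` would have odd multiplicity on the left and
even multiplicity on the right. -/
theorem Polynomial.eq_zero_of_squarefree_mul_sq_eq {F : Type*} [Field F] {h U V : F[X]} {c : F}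
    (hsq : Squarefree h) (hdeg : 0 < h.natDegree) (hc : c ≠ 0) (he : h * U ^ 2 = C c * V ^ 2) :
    U = 0 ∧ V = 0 := by
  classical
  have h0 : h ≠ 0 := hsq.ne_zero
  have hCc : C c ≠ (0 : F[X]) := C_ne_zero.mpr hc
  by_cases hU : U = 0
  · refine ⟨hU, ?_⟩
    subst hU
    simpa [hc] using he.symm
  have hV : V ≠ 0 := by
    rintro rfl
    simp [h0, hU] at he
  exfalso
  have hnu : ¬ IsUnit h := fun hu => by
    have := natDegree_eq_zero_of_isUnit hu
    omega
  obtain ⟨π, hπ⟩ := UniqueFactorizationMonoid.exists_mem_normalizedFactors h0 hnu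
  have hcount := Multiset.count_eq_one_of_mem
    ((UniqueFactorizationMonoid.squarefree_iff_nodup_normalizedFactors h0).mp hsq) hπ
  have h1 := congrArg (fun f => Multiset.count π (UniqueFactorizationMonoid.normalizedFactors f)) he
  simp only [UniqueFactorizationMonoid.normalizedFactors_mul h0 (pow_ne_zero 2 hU),
    UniqueFactorizationMonoid.normalizedFactors_mul hCc (pow_ne_zero 2 hV),
    UniqueFactorizationMonoid.normalizedFactors_pow, Multiset.count_add, Multiset.count_nsmul,
    hcount, UniqueFactorizationMonoid.normalizedFactors_of_isUnit
      (isUnit_C.mpr (isUnit_iff_ne_zero.mpr hc)), Multiset.count_zero] at h1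
  omega

theorem Polynomial.natDegree_le_of_degree_lt_succ {F : Type*} [Field F] {f : F[X]} {D : ℕ}
    (h : f.degree < (D + 1 : ℕ)) : f.natDegree ≤ D := by
  by_cases hf : f = 0
  · simp [hf]
  · exact Nat.lt_succ_iff.mp ((natDegree_lt_iff_degree_lt hf).mpr h)

variable {F : Type*} [Field F] {p : ℕ} [Fact p.Prime] [CharP F p]

/-- Multiplying by `h * (U - V * h ^ r)` gives h U² - V² h^P with P = 2r + 1. Modulo X^P the
Frobenius power h^P is the constant h(0)^P = c, so X^P divides h U² - c V², whose degree is below P.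
It therefore vanishes, and squarefreeness of `h` finishes. -/
theorem Polynomial.eq_zero_of_X_pow_dvd_add_mul_pow {h U V : F[X]} {s r m D : ℕ}
    (hP : p ^ s = 2 * r + 1) (hsq : Squarefree h) (hdeg : 0 < h.natDegree)
    (hm : h.natDegree ≤ 2 * m) (hh0 : h.coeff 0 ≠ 0) (hD : D + m ≤ r)
    (hU : U.degree < D) (hV : V.degree < D) (hdvd : X ^ (p ^ s) ∣ U + V * h ^ r) :
    U = 0 ∧ V = 0 := by
  set c := h.coeff 0 ^ p ^ s with hc
  have h1 : X ^ (p ^ s) ∣ h ^ (p ^ s) - C c := by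
    rw [hc, C_pow, ← sub_pow_char_pow]
    exact pow_dvd_pow_of_dvd (X_dvd_iff.mpr (by simp)) _
  have h2 : h * U ^ 2 - C c * V ^ 2 =
      h * (U - V * h ^ r) * (U + V * h ^ r) + V ^ 2 * (h ^ (p ^ s) - C c) := by
    rw [hP]; ring
  have h3 : X ^ (p ^ s) ∣ h * U ^ 2 - C c * V ^ 2 := by
    rw [h2]
    exact dvd_add (hdvd.mul_left _) (h1.mul_left _)
  have hlt : (h * U ^ 2 - C c * V ^ 2).degree < (p ^ s : ℕ) := by
    refine lt_of_le_of_lt (degree_sub_le _ _) (max_lt ?_ ?_)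
    · by_cases hU0 : U = 0
      · simp only [hU0, ne_eq, OfNat.ofNat_ne_zero, not_false_eq_true, zero_pow, mul_zero, degree_zero]
        exact WithBot.bot_lt_coe _
      refine lt_of_le_of_lt degree_le_natDegree ?_
      have := (natDegree_lt_iff_degree_lt hU0).mpr hU
      have h4 : (h * U ^ 2).natDegree ≤ h.natDegree + 2 * U.natDegree :=
        natDegree_mul_le.trans (by gcongr; exact natDegree_pow_le)
      exact_mod_cast (show (h * U ^ 2).natDegree < p ^ s by omega)
    · by_cases hV0 : V = 0
      · simp only [hV0, ne_eq, OfNat.ofNat_ne_zero, not_false_eq_true, zero_pow, mul_zero, degree_zero]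
        exact WithBot.bot_lt_coe _
      refine lt_of_le_of_lt degree_le_natDegree ?_
      have := (natDegree_lt_iff_degree_lt hV0).mpr hV
      have h4 : (C c * V ^ 2).natDegree ≤ 2 * V.natDegree :=
        (natDegree_C_mul_le _ _).trans natDegree_pow_le
      exact_mod_cast (show (C c * V ^ 2).natDegree < p ^ s by omega)
  have h5 : h * U ^ 2 - C c * V ^ 2 = 0 := by
    by_contra hne
    have := degree_le_of_dvd h3 hne
    rw [degree_X_pow] at this
    exact absurd (this.trans_lt hlt) (lt_irrefl _)
  exact eq_zero_of_squarefree_mul_sq_eq hsq hdeg (pow_ne_zero _ hh0) (sub_eq_zero.mp h5)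

/-- The blocks are peeled off from the lowest power of X^P. This independence guarantees that
Stepanov's auxiliary polynomial is nonzero. -/
theorem Polynomial.eq_zero_of_sum_add_mul_pow_eq_zero {h : F[X]} {s r m D : ℕ}
    (hP : p ^ s = 2 * r + 1) (hsq : Squarefree h) (hdeg : 0 < h.natDegree)
    (hm : h.natDegree ≤ 2 * m) (hh0 : h.coeff 0 ≠ 0) (hD : D + m ≤ r) (J : ℕ) (U V : ℕ → F[X])
    (hU : ∀ j, (U j).degree < D) (hV : ∀ j, (V j).degree < D)
    (hsum : ∑ j ∈ Finset.range J, (U j + V j * h ^ r) * (X ^ (p ^ s)) ^ j = 0) :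
    ∀ j < J, U j = 0 ∧ V j = 0 := by
  induction J generalizing U V with
  | zero => intro j hj; omega
  | succ J ih =>
    rw [Finset.sum_range_succ'] at hsum
    have hfac : ∑ j ∈ Finset.range J, (U (j + 1) + V (j + 1) * h ^ r) * (X ^ (p ^ s)) ^ (j + 1) =
        X ^ (p ^ s) * ∑ j ∈ Finset.range J,
          (U (j + 1) + V (j + 1) * h ^ r) * (X ^ (p ^ s)) ^ j := by
      rw [Finset.mul_sum]
      exact Finset.sum_congr rfl fun j _ => by ring
    rw [hfac, pow_zero, mul_one] at hsum
    have h0 := eq_zero_of_X_pow_dvd_add_mul_pow hP hsq hdeg hm hh0 hD (hU 0) (hV 0)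
      ((dvd_add_right (dvd_mul_right _ _)).mp (hsum ▸ dvd_zero _))
    rw [h0.1, h0.2, zero_mul, add_zero, add_zero] at hsum
    have h1 := ih (fun j => U (j + 1)) (fun j => V (j + 1)) (fun j => hU _) (fun j => hV _)
      ((mul_eq_zero.mp hsum).resolve_left (pow_ne_zero _ X_ne_zero))
    intro j hj
    cases j with
    | zero => exact h0
    | succ j => exact h1 j (by omega)

/-- The polynomial of degree less than `D` with the given coefficients. -/
noncomputable def Polynomial.ofFin {D : ℕ} (a : Fin D → F) : F[X] := ∑ i : Fin D, C (a i) * X ^ (i : ℕ)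

theorem Polynomial.coeff_ofFin {D : ℕ} (a : Fin D → F) (i : Fin D) : (ofFin a).coeff i = a i := by
  simp [ofFin, coeff_X_pow, Fin.val_inj]

theorem Polynomial.degree_ofFin_lt {D : ℕ} (a : Fin D → F) : (ofFin a).degree < D := by
  unfold ofFin
  refine (Finset.sum_induction _ (fun f : F[X] => f ∈ degreeLT F D) (fun _ _ => add_mem)
    (zero_mem _) fun i _ => ?_) |> mem_degreeLT.mp
  rw [mem_degreeLT]
  refine (degree_C_mul_X_pow_le _ _).trans_lt ?_
  exact_mod_cast i.2

/-- The linear system whose solutions produce Stepanov's auxiliary polynomial. -/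
theorem Polynomial.exists_stepanov_coeffs {g : F[X]} {P D J M G : ℕ} (e : F)
    (hg : g.natDegree ≤ G) (hD : 1 ≤ D) (hM : P * (D - 1) + G + J ≤ M) (hlt : M < 2 * (J * D)) :
    ∃ a b : Fin J → Fin D → F, (a ≠ 0 ∨ b ≠ 0) ∧
      ∑ j : Fin J, ∑ i : Fin D, (C (a j i) * g + C (e * b j i)) * X ^ (P * i + j : ℕ) = 0 := by
  let Φ : ((Fin J → Fin D → F) × (Fin J → Fin D → F)) →ₗ[F] F[X] :=
    { toFun := fun q => ∑ j : Fin J, ∑ i : Fin D,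
        (C (q.1 j i) * g + C (e * q.2 j i)) * X ^ (P * i + j : ℕ)
      map_add' := fun q q' => by
        simp only [← Finset.sum_add_distrib]
        refine Finset.sum_congr rfl fun j _ => Finset.sum_congr rfl fun i _ => ?_
        simp only [Prod.fst_add, Prod.snd_add, Pi.add_apply, C_add, mul_add]
        ring
      map_smul' := fun c q => by
        simp only [Finset.smul_sum, RingHom.id_apply]
        refine Finset.sum_congr rfl fun j _ => Finset.sum_congr rfl fun i _ => ?_
        simp only [Prod.smul_fst, Prod.smul_snd, Pi.smul_apply, smul_eq_mul, C_mul, smul_eq_C_mul]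
        ring }
  have hΦ : ∀ q, Φ q ∈ degreeLT F M := by
    intro q
    simp only [Φ, LinearMap.coe_mk, AddHom.coe_mk]
    refine (degreeLT F M).sum_mem fun j _ => (degreeLT F M).sum_mem fun i _ => ?_
    rw [mem_degreeLT]
    refine lt_of_le_of_lt degree_le_natDegree ?_
    have h1 : (C (q.1 j i) * g + C (e * q.2 j i)).natDegree ≤ G := by
      refine (natDegree_add_le _ _).trans (max_le ((natDegree_C_mul_le _ _).trans hg) ?_)
      rw [natDegree_C]
      exact Nat.zero_le _
    have h2 := (natDegree_mul_le (p := C (q.1 j i) * g + C (e * q.2 j i))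
      (q := X ^ (P * i + j : ℕ)))
    rw [natDegree_X_pow] at h2
    have h3 : P * (i : ℕ) ≤ P * (D - 1) := Nat.mul_le_mul_left _ (by have := i.2; omega)
    have h4 := j.2
    exact_mod_cast (show ((C (q.1 j i) * g + C (e * q.2 j i)) * X ^ (P * i + j : ℕ)).natDegree < M
      by omega)
  have hker : LinearMap.ker (Φ.codRestrict (degreeLT F M) hΦ) ≠ ⊥ := by
    have : Module.Finite F (degreeLT F M) := Module.Finite.equiv (degreeLTEquiv F M).symm
    refine LinearMap.ker_ne_bot_of_finrank_lt ?_
    rw [(degreeLTEquiv F M).finrank_eq]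
    simp only [Module.finrank_self, mul_one, Module.finrank_prod, Module.finrank_pi_fintype,
      Finset.sum_const, Finset.card_univ, Fintype.card_fin, smul_eq_mul]
    omega
  obtain ⟨q, hq, hq0⟩ := Submodule.exists_mem_ne_zero_of_ne_bot hker
  refine ⟨q.1, q.2, ?_, ?_⟩
  · by_contra! hne
    exact hq0 (Prod.ext hne.1 hne.2)
  · have := LinearMap.mem_ker.mp hq
    exact congrArg Subtype.val this

variable [Fintype F] [DecidableEq F]

/-- **Stepanov's bound**: over a field with `P ^ 2` elements, a fixed power residue class of a
squarefree polynomial is taken about half of the time at most. -/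
theorem Polynomial.card_pow_eval_eq_le {h : F[X]} {s r m : ℕ} (hP : p ^ s = 2 * r + 1)
    (hcard : Fintype.card F = (p ^ s) ^ 2) (hsq : Squarefree h) (hdeg : 0 < h.natDegree)
    (hm : h.natDegree ≤ 2 * m) (hh0 : h.coeff 0 ≠ 0) (hr : 2 * m + 2 ≤ r) {e : F} (he : e ≠ 0) :
    (Finset.univ.filter fun x : F => h.eval x ^ (r * (p ^ s + 1)) = e).card ≤
      2 * r ^ 2 + 6 * m * r + 4 * r + m := by
  obtain ⟨D, rfl⟩ : ∃ D, r = D + m + 1 := ⟨r - m - 1, by omega⟩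
  set r := D + m + 1 with hrdef
  set P := p ^ s with hPdef
  -- With coefficient polynomials of degree below `D + 1 = r - m`, there are 2J(r - m) unknowns
  -- against 2r² + m + 1 linear conditions; this `J` makes the unknowns win when `2 * m + 2 ≤ r`.
  set J := r + 2 * m + 2 with hJ
  set g := h ^ r with hg
  have hgdeg : g.natDegree ≤ 2 * m * r := by
    refine natDegree_pow_le.trans ?_
    rw [mul_comm]
    gcongr
  obtain ⟨a, b, hab, hZ⟩ := exists_stepanov_coeffs (g := g) (P := P) (D := D + 1) (J := J)
    (M := P * D + 2 * m * r + J) e hgdeg (by omega) (by simp) (by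
      rw [hP, hJ, hrdef]
      have : m ≤ D := by omega
      obtain ⟨t, rfl⟩ := Nat.exists_eq_add_of_le this
      nlinarith [Nat.zero_le t, Nat.zero_le m, mul_nonneg (Nat.zero_le t) (Nat.zero_le m)])
  -- The auxiliary polynomial gets the `P`-th roots of the solved coefficients, so that raising its
  -- values to the power `P` restores them.
  have hfrob : ∀ x : F, ∃ y, y ^ P = x := fun x =>
    ⟨(iterateFrobeniusEquiv F p s).symm x, by
      rw [hPdef, ← iterateFrobenius_def, ← iterateFrobeniusEquiv_apply,
        RingEquiv.apply_symm_apply]⟩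
  choose φ hφ using hfrob
  have hφ0 : ∀ x, φ x = 0 → x = 0 := fun x hx => by
    rw [← hφ x, hx, zero_pow (by omega)]
  let U : ℕ → F[X] := fun j => if hj : j < J then ofFin fun i => φ (a ⟨j, hj⟩ i) else 0
  let V : ℕ → F[X] := fun j => if hj : j < J then ofFin fun i => φ (b ⟨j, hj⟩ i) else 0
  have hUdeg : ∀ j, (U j).degree < (D + 1 : ℕ) := fun j => by
    simp only [U]
    split_ifs
    · exact degree_ofFin_lt _
    · rw [degree_zero]; exact WithBot.bot_lt_coe _
  have hVdeg : ∀ j, (V j).degree < (D + 1 : ℕ) := fun j => by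
    simp only [V]
    split_ifs
    · exact degree_ofFin_lt _
    · rw [degree_zero]; exact WithBot.bot_lt_coe _
  set R := ∑ j ∈ Finset.range J, (U j + V j * g) * (X ^ P) ^ j with hR
  have hR0 : R ≠ 0 := by
    intro hR0
    have hz := eq_zero_of_sum_add_mul_pow_eq_zero hP hsq hdeg hm hh0 (by omega) J U V hUdeg hVdeg
      hR0
    rcases hab with h1 | h1
    · refine h1 ?_
      ext j i
      refine hφ0 _ ?_
      have := congrArg (fun f => coeff f i) (hz j j.2).1
      simpa only [U, j.2, dif_pos, coeff_ofFin, coeff_zero] using this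
    · refine h1 ?_
      ext j i
      refine hφ0 _ ?_
      have := congrArg (fun f => coeff f i) (hz j j.2).2
      simpa only [V, j.2, dif_pos, coeff_ofFin, coeff_zero] using this
  have hRdeg : R.natDegree ≤ D + 2 * m * r + P * (J - 1) := by
    refine natDegree_sum_le_of_forall_le _ _ fun j hj => ?_
    have hj' := Finset.mem_range.mp hj
    have hUn : (U j).natDegree ≤ D := natDegree_le_of_degree_lt_succ (hUdeg j)
    have hVn : (V j).natDegree ≤ D := natDegree_le_of_degree_lt_succ (hVdeg j)
    have h1 : (U j + V j * g).natDegree ≤ D + 2 * m * r := by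
      refine (natDegree_add_le _ _).trans (max_le (by omega) ?_)
      exact natDegree_mul_le.trans (add_le_add hVn hgdeg)
    refine natDegree_mul_le.trans (add_le_add h1 ?_)
    rw [← pow_mul, natDegree_X_pow]
    exact Nat.mul_le_mul_left _ (by omega)
  -- Since x^(P²) = x, the power R(x)^P has X^(Pj) replaced by x^j and X^i by x^(Pi). Multiplying by
  -- g(x) and using g(x)^(P+1) = e turns it into the linear system evaluated at x, which is zero.
  have hvanish : ∀ x : F, h.eval x ^ (r * (P + 1)) = e → R.eval x = 0 := by
    intro x hx
    have hxQ : x ^ (P * P) = x := by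
      rw [← sq, ← hcard, FiniteField.pow_card]
    have hgP : g.eval x * (g.eval x) ^ P = e := by
      rw [hg, eval_pow, ← hx, ← pow_mul, ← pow_add]
      congr 1
      ring
    have hgx : g.eval x ≠ 0 := fun h0 => he (by rw [← hgP, h0, zero_mul])
    have hfin : ∀ (c : Fin (D + 1) → F),
        ((ofFin fun i => φ (c i)).eval x) ^ P = ∑ i, c i * x ^ (P * i : ℕ) := by
      intro c
      simp only [ofFin, eval_finsetSum, eval_mul, eval_C, eval_pow, eval_X]
      rw [hPdef, sum_pow_char_pow]
      refine Finset.sum_congr rfl fun i _ => ?_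
      rw [mul_pow, ← hPdef, hφ, ← pow_mul, mul_comm (i : ℕ)]
    have hmain : g.eval x * (R.eval x) ^ P = 0 := by
      have h1 : R.eval x = ∑ j : Fin J, ((U j).eval x + (V j).eval x * g.eval x) *
          (x ^ P) ^ (j : ℕ) := by
        rw [hR, eval_finsetSum, Finset.sum_range]
        simp
      have h2 := congrArg (eval x) hZ
      simp only [eval_finsetSum, eval_mul, eval_add, eval_C, eval_pow, eval_X, eval_zero] at h2
      rw [h1, hPdef, sum_pow_char_pow, ← h2, Finset.mul_sum]
      refine Finset.sum_congr rfl fun j _ => ?_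
      rw [mul_pow, add_pow_char_pow, ← hPdef, mul_pow]
      simp only [U, V, j.2, dif_pos, hfin]
      rw [show ((x ^ P) ^ (j : ℕ)) ^ P = x ^ (j : ℕ) by
        rw [← pow_mul, ← pow_mul, show P * (j * P) = P * P * j by ring, pow_mul, hxQ]]
      rw [add_mul, mul_add, Finset.sum_mul, Finset.sum_mul, Finset.sum_mul, Finset.mul_sum,
        Finset.mul_sum, ← Finset.sum_add_distrib]
      refine Finset.sum_congr rfl fun i _ => ?_
      rw [pow_add, ← hgP]
      ring
    exact eq_zero_of_pow_eq_zero ((mul_eq_zero.mp hmain).resolve_left hgx)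
  have hsub : (Finset.univ.filter fun x : F => h.eval x ^ (r * (P + 1)) = e) ⊆ R.roots.toFinset := by
    intro x hx
    rw [Finset.mem_filter] at hx
    rw [Multiset.mem_toFinset, mem_roots hR0]
    exact hvanish x hx.2
  refine (Finset.card_le_card hsub).trans ((Multiset.toFinset_card_le _).trans
    ((card_roots' R).trans (hRdeg.trans ?_)))
  rw [hP, hJ, show r + 2 * m + 2 - 1 = r + 2 * m + 1 by omega]
  nlinarith [hrdef]

end Stepanov

/-! ### The quadratic in X^p - X arising from shifted Kloosterman sums. -/

section ArtinSchreierQuadratic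

open Polynomial

variable {F : Type*} [Field F] {p : ℕ}

/-- The polynomial `(X ^ p - X + s) ^ 2 - 4 e`. -/
noncomputable def artinSchreierQuadratic (p : ℕ) (s e : F) : F[X] := (X ^ p - X + C s) ^ 2 - C (4 * e)

theorem natDegree_artinSchreierQuadratic_le [Fact p.Prime] (s e : F) :
    (artinSchreierQuadratic p s e).natDegree ≤ 2 * p := by
  have hp : 1 ≤ p := (Fact.out : p.Prime).one_lt.le
  refine (natDegree_sub_C (R := F)).trans_le ?_
  refine natDegree_pow_le.trans (Nat.mul_le_mul_left _ ?_)
  refine (natDegree_add_C).trans_le ((natDegree_sub_le _ _).trans (max_le ?_ ?_))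
  · rw [natDegree_X_pow]
  · rw [natDegree_X]; exact hp

variable [CharP F p]

theorem derivative_artinSchreierQuadratic (s e : F) :
    derivative (artinSchreierQuadratic p s e) = -2 * (X ^ p - X + C s) := by
  have : ((p : ℕ) : F) = 0 := CharP.cast_eq_zero F p
  simp only [artinSchreierQuadratic, derivative_sub, derivative_pow, derivative_add, derivative_X,
    derivative_C, this]
  simp [C_ofNat]

/-- With W = X^p - X + s, the polynomial is h = W² - 4e and its derivative is -2W, so h + (W/2)h' =
-4e is a unit: a Bézout relation. -/
theorem squarefree_artinSchreierQuadratic (hF : ringChar F ≠ 2) {e : F} (s : F) (he : e ≠ 0) :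
    Squarefree (artinSchreierQuadratic p s e) := by
  have h2 : (2 : F) ≠ 0 := Ring.two_ne_zero hF
  have h4 : (4 * e : F) ≠ 0 := mul_ne_zero (by
    rw [show (4 : F) = 2 * 2 by norm_num]; exact mul_ne_zero h2 h2) he
  refine Separable.squarefree ?_
  rw [separable_def, derivative_artinSchreierQuadratic]
  refine ⟨C (-(4 * e)⁻¹), C (-(4 * e)⁻¹) * C (2⁻¹) * (X ^ p - X + C s), ?_⟩
  have e1 : C (4 * e)⁻¹ * C (4 * e) = (1 : F[X]) := by rw [← C_mul, inv_mul_cancel₀ h4, C_1]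
  have e2 : C (2 : F)⁻¹ * 2 = (1 : F[X]) := by
    rw [← C_ofNat, ← C_mul, inv_mul_cancel₀ h2, C_1]
  rw [artinSchreierQuadratic, C_neg]
  linear_combination e1 + C (4 * e)⁻¹ * (X ^ p - X + C s) ^ 2 * e2

theorem natDegree_artinSchreierQuadratic_pos [Fact p.Prime] (hF : ringChar F ≠ 2) (s e : F) :
    0 < (artinSchreierQuadratic p s e).natDegree := by
  have h2 : (2 : F) ≠ 0 := Ring.two_ne_zero hF
  have hp : 1 < p := (Fact.out : p.Prime).one_lt
  by_contra h0
  have h1 := derivative_of_natDegree_zero (Nat.eq_zero_of_not_pos h0)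
  rw [derivative_artinSchreierQuadratic] at h1
  have h3 := congrArg (fun f => coeff f 1) h1
  simp only [neg_mul, coeff_neg, coeff_ofNat_mul, coeff_add, coeff_sub, coeff_X_pow, coeff_X_one,
    coeff_C, coeff_zero] at h3
  rw [if_neg (by omega), if_neg (by omega)] at h3
  apply h2
  linear_combination h3

end ArtinSchreierQuadratic

/-! ### Kloosterman sums over fields of square order. -/

section Kloosterman

open Polynomial

variable {F : Type*} [Field F] [Fintype F] [DecidableEq F]

theorem Finset.sum_comp_eq_sum_card_mul {α β : Type*} [Fintype β] [DecidableEq β]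
    (s : Finset α) (g : α → β) (f : β → ℂ) :
    ∑ a ∈ s, f (g a) = ∑ b, ((s.filter fun a => g a = b).card : ℂ) * f b := by
  rw [← Finset.sum_fiberwise s g]
  refine Finset.sum_congr rfl fun b _ => ?_
  rw [← nsmul_eq_mul, ← Finset.sum_const]
  refine Finset.sum_congr rfl fun a ha => ?_
  rw [(Finset.mem_filter.mp ha).2]

/-- The quadratic character with complex values. -/
def quadChar (a : F) : ℂ := (quadraticChar F a : ℂ)

theorem card_sq_eq (hF : ringChar F ≠ 2) (a : F) :
    ((Finset.univ.filter fun x : F => x ^ 2 = a).card : ℂ) = 1 + quadChar a := by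
  have h := quadraticChar_card_sqrts hF a
  have h2 : (Finset.univ.filter fun x : F => x ^ 2 = a) = {x : F | x ^ 2 = a}.toFinset := by
    ext x; simp
  rw [h2, quadChar]
  have := congrArg (Int.cast : ℤ → ℂ) h
  push_cast at this
  rw [this]; ring

theorem card_quadratic_eq (hF : ringChar F ≠ 2) (T N : F) :
    ((Finset.univ.filter fun x : F => x ^ 2 - T * x + N = 0).card : ℂ) =
      1 + quadChar (T ^ 2 - 4 * N) := by
  have h2 : (2 : F) ≠ 0 := Ring.two_ne_zero hF
  rw [← card_sq_eq hF]
  congr 1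
  refine Finset.card_bij' (fun x _ => 2 * x - T) (fun y _ => (y + T) / 2) ?_ ?_ ?_ ?_
  · intro x hx
    simp only [Finset.mem_filter, Finset.mem_univ, true_and] at hx ⊢
    linear_combination 4 * hx
  · intro y hy
    simp only [Finset.mem_filter, Finset.mem_univ, true_and] at hy ⊢
    field_simp
    linear_combination hy
  · intro x _
    field_simp
    ring
  · intro y _
    field_simp
    ring

/-- The Kloosterman sum `∑ ψ(x + e/x)` over nonzero `x`. -/
def kloosterman (ψ : AddChar F ℂ) (e : F) : ℂ := ∑ x : F, if x = 0 then 0 else ψ (x + e * x⁻¹)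

/-- Group by s = x + e/x: the fibre is the root set of x² - sx + e, of size 1 + χ(s² - 4e), and the
1 contributes nothing because `ψ` is nontrivial. -/
theorem kloosterman_eq_sum_quadChar (hF : ringChar F ≠ 2) {ψ : AddChar F ℂ} (hψ : ψ ≠ 1) {e : F}
    (he : e ≠ 0) : kloosterman ψ e = ∑ s, ψ s * quadChar (s ^ 2 - 4 * e) := by
  have h1 : ∑ s, ψ s = 0 := AddChar.sum_eq_zero_of_ne_one hψ
  have h2 : kloosterman ψ e = ∑ x ∈ Finset.univ.filter (fun x : F => x ≠ 0), ψ (x + e * x⁻¹) := by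
    simp only [kloosterman, Finset.sum_filter, ite_not]
  rw [h2, Finset.sum_comp_eq_sum_card_mul _ (fun x => x + e * x⁻¹) (fun s => ψ s)]
  have h3 : ∀ s, (((Finset.univ.filter fun x : F => x ≠ 0).filter
      fun x => x + e * x⁻¹ = s).card : ℂ) = 1 + quadChar (s ^ 2 - 4 * e) := by
    intro s
    rw [← card_quadratic_eq hF, Finset.filter_filter]
    congr 2
    ext x
    simp only [Finset.mem_filter, Finset.mem_univ, true_and]
    constructor
    · rintro ⟨hx, rfl⟩
      field_simp
      ring
    · intro hy
      have hy0 : x ≠ 0 := by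
        rintro rfl
        simp [he] at hy
      refine ⟨hy0, ?_⟩
      field_simp
      linear_combination hy
  simp only [h3, add_mul, one_mul, Finset.sum_add_distrib, h1, zero_add]
  exact Finset.sum_congr rfl fun s _ => mul_comm _ _

theorem quadChar_values (a : F) : quadChar a = 0 ∨ quadChar a = 1 ∨ quadChar a = -1 := by
  by_cases ha : a = 0
  · left; simp [quadChar, ha]
  · right
    rcases quadraticChar_dichotomy ha with h | h <;> simp [quadChar, h]

theorem norm_quadChar_le (a : F) : ‖quadChar a‖ ≤ 1 := by
  rcases quadChar_values a with h | h | h <;> simp [h]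

variable {p : ℕ} [Fact p.Prime] [CharP F p]

/-- By Euler's criterion, Stepanov's bound caps both classes χ(h) = 1 and χ(h) = -1. They cover the
field up to at most 2m roots, so upper bounds near one half force near equality. -/
theorem norm_sum_quadChar_eval_le (hF : ringChar F ≠ 2) {h : F[X]} {s r m : ℕ}
    (hP : p ^ s = 2 * r + 1) (hcard : Fintype.card F = (p ^ s) ^ 2) (hsq : Squarefree h)
    (hdeg : 0 < h.natDegree) (hm : h.natDegree ≤ 2 * m) (hh0 : h.coeff 0 ≠ 0)
    (hr : 2 * m + 2 ≤ r) :
    ‖∑ y, quadChar (h.eval y)‖ ≤ 12 * m * (p ^ s : ℕ) := by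
  have hexp : Fintype.card F / 2 = r * (p ^ s + 1) := by
    rw [hcard, hP]
    have : (2 * r + 1) ^ 2 = 2 * (r * (2 * r + 1 + 1)) + 1 := by ring
    omega
  have hneg : (-1 : F) ≠ 1 := Ring.neg_one_ne_one_of_char_ne_two hF
  set A := Finset.univ.filter fun x : F => quadraticChar F (h.eval x) = 1 with hA
  set B := Finset.univ.filter fun x : F => quadraticChar F (h.eval x) = -1 with hB
  set Z := Finset.univ.filter fun x : F => h.eval x = 0 with hZ
  have hAB : Disjoint A B := by
    rw [Finset.disjoint_filter]
    intro x _ h1 h2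
    rw [h1] at h2
    norm_num at h2
  have hABZ : Disjoint (A ∪ B) Z := by
    rw [Finset.disjoint_left]
    intro x hx hz
    simp only [hA, hB, hZ, Finset.mem_union, Finset.mem_filter, Finset.mem_univ, true_and] at hx hz
    rw [hz, quadraticChar_zero] at hx
    norm_num at hx
  have hun : A ∪ B ∪ Z = Finset.univ := by
    ext x
    simp only [hA, hB, hZ, Finset.mem_union, Finset.mem_filter, Finset.mem_univ, true_and, iff_true]
    by_cases hx : h.eval x = 0
    · exact Or.inr hx
    · exact Or.inl (quadraticChar_dichotomy hx)
  have hcount : A.card + B.card + Z.card = Fintype.card F := by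
    rw [← Finset.card_union_of_disjoint hAB, ← Finset.card_union_of_disjoint hABZ, hun,
      Finset.card_univ]
  have hZc : Z.card ≤ 2 * m := by
    have hne : h ≠ 0 := hsq.ne_zero
    have : Z ⊆ h.roots.toFinset := by
      intro x hx
      rw [Multiset.mem_toFinset, mem_roots hne]
      exact (Finset.mem_filter.mp hx).2
    exact (Finset.card_le_card this).trans ((Multiset.toFinset_card_le _).trans
      ((card_roots' h).trans hm))
  have hAc : A.card ≤ 2 * r ^ 2 + 6 * m * r + 4 * r + m := by
    refine le_trans (Finset.card_le_card ?_)
      (card_pow_eval_eq_le hP hcard hsq hdeg hm hh0 hr one_ne_zero)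
    intro x hx
    simp only [hA, Finset.mem_filter, Finset.mem_univ, true_and] at hx ⊢
    have := quadraticChar_eq_pow_of_char_ne_two' hF (h.eval x)
    rw [hx, hexp] at this
    simpa using this.symm
  have hBc : B.card ≤ 2 * r ^ 2 + 6 * m * r + 4 * r + m := by
    refine le_trans (Finset.card_le_card ?_)
      (card_pow_eval_eq_le hP hcard hsq hdeg hm hh0 hr (neg_ne_zero.mpr one_ne_zero))
    intro x hx
    simp only [hB, Finset.mem_filter, Finset.mem_univ, true_and] at hx ⊢
    have := quadraticChar_eq_pow_of_char_ne_two' hF (h.eval x)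
    rw [hx, hexp] at this
    simpa using this.symm
  have hsum : ∑ y, quadChar (h.eval y) = ((A.card : ℝ) - (B.card : ℝ) : ℝ) := by
    have h1 : ∀ y, quadChar (h.eval y) = (if quadraticChar F (h.eval y) = 1 then (1 : ℂ) else 0) -
        (if quadraticChar F (h.eval y) = -1 then 1 else 0) := by
      intro y
      by_cases hy : h.eval y = 0
      · simp [quadChar, hy]
      · rcases quadraticChar_dichotomy hy with h | h <;> simp [quadChar, h]
    simp only [h1, Finset.sum_sub_distrib, Finset.sum_boole, hA, hB]
    push_cast
    rfl
  rw [hsum, Complex.norm_real, Real.norm_eq_abs, abs_le]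
  have hQ : Fintype.card F = 4 * r ^ 2 + 4 * r + 1 := by rw [hcard, hP]; ring
  have hm1 : 1 ≤ m := by omega
  rw [hQ] at hcount
  rw [hP]
  have hc : (A.card : ℝ) + B.card + Z.card = 4 * r ^ 2 + 4 * r + 1 := by exact_mod_cast hcount
  have hZ' : (Z.card : ℝ) ≤ 2 * m := by exact_mod_cast hZc
  have hA' : (A.card : ℝ) ≤ 2 * r ^ 2 + 6 * m * r + 4 * r + m := by exact_mod_cast hAc
  have hB' : (B.card : ℝ) ≤ 2 * r ^ 2 + 6 * m * r + 4 * r + m := by exact_mod_cast hBc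
  have hm' : (1 : ℝ) ≤ m := by exact_mod_cast hm1
  have hr' : (0 : ℝ) ≤ r := Nat.cast_nonneg r
  push_cast
  constructor <;> nlinarith [mul_nonneg hr' (sub_nonneg.mpr hm')]

/-- A bound for Kloosterman sums of the right order in the size of the field, with a constant
depending on the characteristic. -/
theorem norm_kloosterman_le_of_card_eq_sq (hF : ringChar F ≠ 2) {ψ : AddChar F ℂ} (hψ : ψ ≠ 1)
    (hfrob : ∀ x, ψ (x ^ p) = ψ x) {e : F} (he : e ≠ 0) {s r : ℕ}
    (hP : p ^ s = 2 * r + 1) (hcard : Fintype.card F = (p ^ s) ^ 2) (hr : 2 * p + 2 ≤ r) :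
    ‖kloosterman ψ e‖ ≤ 14 * p * (p ^ s : ℕ) := by
  set Q : ℝ := (Fintype.card F : ℝ) with hQ
  have hQ0 : 0 < Q := Nat.cast_pos.mpr Fintype.card_pos
  set S : F → ℂ := fun t => ∑ y, quadChar ((artinSchreierQuadratic p t e).eval y) with hS
  have hp1 : (1 : ℝ) ≤ p := by exact_mod_cast (Fact.out : p.Prime).one_lt.le
  have hP1 : (1 : ℝ) ≤ (p ^ s : ℕ) := by rw [hP]; push_cast; linarith [Nat.cast_nonneg (α := ℝ) r]
  -- Frobenius invariance gives ψ(y^p - y) = 1, so shifting s by y^p - y leaves the weight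
  -- unchanged. Averaging over y produces complete character sums, where Stepanov's bound saves a
  -- square root.
  have key : (Fintype.card F : ℂ) * kloosterman ψ e = ∑ t, ψ t * S t := by
    have h1 : ∀ y : F, kloosterman ψ e =
        ∑ t, ψ t * quadChar ((artinSchreierQuadratic p t e).eval y) := by
      intro y
      rw [kloosterman_eq_sum_quadChar hF hψ he, ← Equiv.sum_comp (Equiv.addRight (y ^ p - y))]
      refine Finset.sum_congr rfl fun t _ => ?_
      simp only [Equiv.coe_addRight, artinSchreierQuadratic, eval_sub, eval_pow, eval_add, eval_X,
        eval_C]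
      rw [AddChar.map_add_eq_mul, AddChar.map_sub_eq_div, hfrob,
        div_self (by rw [← norm_ne_zero_iff]; simp), mul_one]
      congr 2
      ring
    calc (Fintype.card F : ℂ) * kloosterman ψ e = ∑ _y : F, kloosterman ψ e := by
          rw [Finset.sum_const, nsmul_eq_mul, Finset.card_univ]
      _ = ∑ y : F, ∑ t, ψ t * quadChar ((artinSchreierQuadratic p t e).eval y) :=
          Finset.sum_congr rfl fun y _ => h1 y
      _ = _ := by
          rw [Finset.sum_comm]
          exact Finset.sum_congr rfl fun t _ => by rw [hS, Finset.mul_sum]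
  -- When t² = 4e the constant coefficient vanishes and Stepanov's bound does not apply; there are
  -- at most two such t, so the trivial bound suffices.
  have hbound : ∀ t, ‖ψ t * S t‖ ≤
      12 * p * (p ^ s : ℕ) + if t ^ 2 = 4 * e then Q else 0 := by
    intro t
    rw [norm_mul, AddChar.norm_apply, one_mul]
    split_ifs with ht
    · have : ‖S t‖ ≤ Q := by
        refine (norm_sum_le _ _).trans ((Finset.sum_le_sum fun y _ => norm_quadChar_le _).trans ?_)
        simp [hQ]
      have h0 : (0 : ℝ) ≤ 12 * p * (p ^ s : ℕ) := by positivity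
      linarith
    · rw [add_zero]
      refine norm_sum_quadChar_eval_le hF hP hcard (squarefree_artinSchreierQuadratic hF t he)
        (natDegree_artinSchreierQuadratic_pos hF t e) (natDegree_artinSchreierQuadratic_le t e) ?_ hr
      have hp0 : p ≠ 0 := (Fact.out : p.Prime).ne_zero
      rw [coeff_zero_eq_eval_zero]
      simp only [artinSchreierQuadratic, eval_sub, eval_pow, eval_add, eval_X, eval_C,
        zero_pow hp0, sub_zero, zero_add]
      exact sub_ne_zero.mpr ht
  have hfew : ((Finset.univ.filter fun t : F => t ^ 2 = 4 * e).card : ℝ) ≤ 2 := by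
    have h1 := card_sq_eq hF (4 * e)
    have h2 : ‖((Finset.univ.filter fun t : F => t ^ 2 = 4 * e).card : ℂ)‖ ≤ 2 := by
      rw [h1]
      refine (norm_add_le _ _).trans ?_
      rw [norm_one]
      linarith [norm_quadChar_le (4 * e)]
    simpa using h2
  have h3 : Q * ‖kloosterman ψ e‖ ≤ Q * (14 * p * (p ^ s : ℕ)) := by
    calc Q * ‖kloosterman ψ e‖ = ‖∑ t, ψ t * S t‖ := by
          rw [← key, norm_mul, Complex.norm_natCast]
      _ ≤ ∑ t : F, (12 * p * (p ^ s : ℕ) + if t ^ 2 = 4 * e then Q else 0) :=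
          (norm_sum_le _ _).trans (Finset.sum_le_sum fun t _ => hbound t)
      _ = Q * (12 * p * (p ^ s : ℕ)) +
          (Finset.univ.filter fun t : F => t ^ 2 = 4 * e).card * Q := by
          rw [Finset.sum_add_distrib, Finset.sum_const, nsmul_eq_mul, Finset.card_univ,
            ← Finset.sum_filter, Finset.sum_const, nsmul_eq_mul]
      _ ≤ Q * (12 * p * (p ^ s : ℕ)) + 2 * Q := by gcongr
      _ ≤ Q * (14 * p * (p ^ s : ℕ)) := by nlinarith [mul_le_mul hp1 hP1 zero_le_one (by linarith)]
  exact le_of_mul_le_mul_left h3 hQ0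

end Kloosterman

/-! ### Kloosterman sums in a quadratic extension. -/

section QuadraticExtension

universe u

variable {F : Type u} [Field F]

open QuadraticAlgebra

noncomputable instance QuadraticAlgebra.instFintype {R : Type*} [Fintype R] {a b : R} :
    Fintype (QuadraticAlgebra R a b) := Fintype.ofEquiv _ (equivProd a b).symm

theorem QuadraticAlgebra.card_eq {R : Type*} [Fintype R] {a b : R} :
    Fintype.card (QuadraticAlgebra R a b) = Fintype.card R ^ 2 := by
  rw [Fintype.card_congr (equivProd a b), Fintype.card_prod, sq]

theorem QuadraticAlgebra.trace_pow_char {a b : F} {p : ℕ} [Fact p.Prime] [CharP F p]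
    (z : QuadraticAlgebra F a b) : trace (z ^ p) = trace z ^ p := by
  have hchar : CharP (QuadraticAlgebra F a b) p := charP_of_injective_algebraMap
    (FaithfulSMul.algebraMap_injective F (QuadraticAlgebra F a b)) p
  apply FaithfulSMul.algebraMap_injective F (QuadraticAlgebra F a b)
  rw [algebraMap_trace_eq_add_star, map_pow, algebraMap_trace_eq_add_star, star_pow,
    add_pow_char]

variable [Fintype F] [DecidableEq F]

/-- For z = T/2 + y√δ one has T² - 4N = 4δy², and χ(δ) = -1 flips the sign. The split count
`card_add_mul_eq` carries the opposite sign, so the two add up to 2. -/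
theorem card_trace_norm_eq (hF : ringChar F ≠ 2) {δ : F} (hδ : ¬ IsSquare δ) (T N : F) :
    ((Finset.univ.filter fun z : QuadraticAlgebra F δ 0 => (trace z, norm z) = (T, N)).card : ℂ) =
      1 - quadChar (T ^ 2 - 4 * N) := by
  have h2 : (2 : F) ≠ 0 := Ring.two_ne_zero hF
  have hδ0 : δ ≠ 0 := by
    rintro rfl
    exact hδ IsSquare.zero
  have h4 : quadChar (T ^ 2 - 4 * N) = - quadChar ((T ^ 2 - 4 * N) / (4 * δ)) := by
    have e1 : T ^ 2 - 4 * N = δ * (2 ^ 2 * ((T ^ 2 - 4 * N) / (4 * δ))) := by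
      rw [show (2 : F) ^ 2 = 4 by norm_num]
      have : (4 : F) ≠ 0 := by rw [show (4 : F) = 2 * 2 by norm_num]; exact mul_ne_zero h2 h2
      field_simp
    conv_lhs => rw [e1]
    rw [quadChar, map_mul, map_mul, quadraticChar_sq_one' h2,
      quadraticChar_neg_one_iff_not_isSquare.mpr hδ, quadChar]
    push_cast
    ring
  rw [h4, sub_neg_eq_add, ← card_sq_eq hF]
  congr 1
  have hkey : ∀ y : F, y ^ 2 = (T ^ 2 - 4 * N) / (4 * δ) ↔ (T / 2) ^ 2 - δ * y ^ 2 = N := by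
    intro y
    have : (4 : F) ≠ 0 := by rw [show (4 : F) = 2 * 2 by norm_num]; exact mul_ne_zero h2 h2
    rw [eq_div_iff (mul_ne_zero this hδ0), div_pow, show (2 : F) ^ 2 = 4 by norm_num]
    constructor
    · intro h
      field_simp
      linear_combination -h
    · intro h
      field_simp at h
      linear_combination -h
  refine Finset.card_bij' (fun z _ => z.im) (fun y _ => ⟨T / 2, y⟩) ?_ ?_ ?_ ?_
  · intro z hz
    simp only [Finset.mem_filter, Finset.mem_univ, true_and, Prod.mk.injEq, trace_def,
      norm_def] at hz ⊢
    rw [hkey, ← hz.2, ← hz.1]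
    field_simp
    ring
  · intro y hy
    simp only [Finset.mem_filter, Finset.mem_univ, true_and, Prod.mk.injEq, trace_def,
      norm_def] at hy ⊢
    rw [hkey] at hy
    refine ⟨by field_simp; ring, ?_⟩
    rw [← hy]
    ring
  · intro z hz
    simp only [Finset.mem_filter, Finset.mem_univ, true_and, Prod.mk.injEq, trace_def,
      norm_def] at hz
    ext
    · rw [← hz.1]
      field_simp
      ring
    · rfl
  · intro y _
    rfl

theorem card_add_mul_eq (hF : ringChar F ≠ 2) (T N : F) :
    ((Finset.univ.filter fun z : F × F => (z.1 + z.2, z.1 * z.2) = (T, N)).card : ℂ) =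
      1 + quadChar (T ^ 2 - 4 * N) := by
  rw [← card_quadratic_eq hF]
  congr 1
  refine Finset.card_bij' (fun z _ => z.1) (fun x _ => (x, T - x)) ?_ ?_ ?_ ?_
  · intro z hz
    simp only [Finset.mem_filter, Finset.mem_univ, true_and, Prod.mk.injEq] at hz ⊢
    rw [← hz.1, ← hz.2]
    ring
  · intro x hx
    simp only [Finset.mem_filter, Finset.mem_univ, true_and, Prod.mk.injEq] at hx ⊢
    exact ⟨by ring, by linear_combination -hx⟩
  · intro z hz
    simp only [Finset.mem_filter, Finset.mem_univ, true_and, Prod.mk.injEq] at hz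
    ext
    · rfl
    · rw [← hz.1]; ring
  · intro x _
    rfl

/-- The Davenport–Hasse relation for Kloosterman sums in a quadratic extension. -/
theorem kloosterman_quadraticAlgebra (hF : ringChar F ≠ 2) {ψ : AddChar F ℂ} (hψ : ψ ≠ 1) {e : F}
    (he : e ≠ 0) {δ : F} (hδ : ¬ IsSquare δ) [Fact (∀ r : F, r ^ 2 ≠ δ + 0 * r)]
    [DecidableEq (QuadraticAlgebra F δ 0)] :
    kloosterman (ψ.compAddMonoidHom (trace (R := F) (a := δ) (b := 0)).toAddMonoidHom)
      (algebraMap F _ e) = 2 * Fintype.card F - kloosterman ψ e ^ 2 := by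
  -- Both z + e/z under the trace, and x + y + e/x + e/y, equal T + eT/N in terms of trace and norm,
  -- or of sum and product. So both sums are weighted sums of the same `f`.
  set f : F × F → ℂ := fun q => if q.2 = 0 then 0 else ψ (q.1 + e * (q.1 / q.2)) with hf
  have hL : kloosterman (ψ.compAddMonoidHom (trace (R := F) (a := δ) (b := 0)).toAddMonoidHom)
      (algebraMap F _ e) = ∑ q : F × F, (1 - quadChar (q.1 ^ 2 - 4 * q.2)) * f q := by
    have h1 : kloosterman (ψ.compAddMonoidHom (trace (R := F) (a := δ) (b := 0)).toAddMonoidHom)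
        (algebraMap F _ e) =
        ∑ z : QuadraticAlgebra F δ 0, f (trace z, norm z) := by
      refine Finset.sum_congr rfl fun z _ => ?_
      simp only [hf, norm_eq_zero_iff_eq_zero]
      by_cases hz : z = 0
      · simp [hz]
      · rw [if_neg hz, if_neg hz]
        simp only [AddChar.compAddMonoidHom_apply, LinearMap.toAddMonoidHom_coe]
        rw [map_add, inv_def, ← Algebra.smul_def, map_smul, map_smul, trace_star, smul_eq_mul,
          smul_eq_mul, div_eq_inv_mul]
    rw [h1, Finset.sum_comp_eq_sum_card_mul _ (fun z : QuadraticAlgebra F δ 0 =>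
      (trace z, norm z)) f]
    exact Finset.sum_congr rfl fun q _ => by rw [← card_trace_norm_eq hF hδ]
  have hK : kloosterman ψ e ^ 2 = ∑ q : F × F, (1 + quadChar (q.1 ^ 2 - 4 * q.2)) * f q := by
    have h1 : kloosterman ψ e ^ 2 = ∑ z : F × F, f (z.1 + z.2, z.1 * z.2) := by
      rw [sq, kloosterman, Finset.sum_mul_sum, ← Finset.sum_product', Finset.univ_product_univ]
      refine Finset.sum_congr rfl fun z _ => ?_
      simp only [hf, mul_eq_zero]
      by_cases h1 : z.1 = 0
      · simp [h1]
      by_cases h2 : z.2 = 0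
      · simp [h2]
      rw [if_neg h1, if_neg h2, if_neg (by tauto), ← AddChar.map_add_eq_mul]
      congr 1
      field_simp
      ring
    rw [h1, Finset.sum_comp_eq_sum_card_mul _ (fun z : F × F => (z.1 + z.2, z.1 * z.2)) f]
    exact Finset.sum_congr rfl fun q _ => by rw [← card_add_mul_eq hF]
  have hsum : ∑ q : F × F, f q = Fintype.card F := by
    rw [Fintype.sum_prod_type_right]
    have hprim : ψ.IsPrimitive := AddChar.IsPrimitive.of_ne_one hψ
    -- For N ≠ 0 the argument is T(N + e)/N, linear in T, so only N = -e survives.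
    have h1 : ∀ N : F, ∑ T : F, f (T, N) = if N = -e then (Fintype.card F : ℂ) else 0 := by
      intro N
      by_cases hN : N = 0
      · subst hN
        rw [if_neg (by intro h; exact he (neg_eq_zero.mp h.symm))]
        simp [hf]
      · simp only [hf, if_neg hN]
        have h2 : ∀ T : F, T + e * (T / N) = T * ((N + e) / N) := fun T => by field_simp
        simp only [h2]
        rw [AddChar.sum_mulShift _ hprim]
        simp only [div_eq_zero_iff, hN, or_false, add_eq_zero_iff_eq_neg]
        push_cast
        rfl
    simp only [h1, Finset.sum_ite_eq', Finset.mem_univ, if_true]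
  rw [hL, hK, eq_sub_iff_add_eq, ← Finset.sum_add_distrib, ← hsum, Finset.mul_sum]
  exact Finset.sum_congr rfl fun q _ => by ring

end QuadraticExtension

/-! ### Weil's bound by amplification in a tower. -/

section WeilBound

universe u

/-- Over a tower of quadratic extensions, a Kloosterman sum exceeding the Weil bound keeps growing
relative to the square root of the field size. -/
theorem exists_kloosterman_tower {p : ℕ} [Fact p.Prime] (hp2 : p ≠ 2) {F : Type u} [Field F]
    [Fintype F] [DecidableEq F] [CharP F p] {ψ : AddChar F ℂ} (hψ : ψ ≠ 1)
    (hfrob : ∀ x, ψ (x ^ p) = ψ x) {e : F} (he : e ≠ 0) {ε : ℝ} (hε : 0 ≤ ε)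
    (hK : (2 + ε) * √(Fintype.card F) ≤ ‖kloosterman ψ e‖) (j : ℕ) :
    ∃ (L : Type u) (_ : Field L) (_ : Fintype L) (_ : DecidableEq L) (_ : CharP L p)
      (ψ' : AddChar L ℂ) (e' : L), ψ' ≠ 1 ∧ (∀ x, ψ' (x ^ p) = ψ' x) ∧ e' ≠ 0 ∧
        Fintype.card L = Fintype.card F ^ 2 ^ j ∧
        (2 + 4 ^ j * ε) * √(Fintype.card L) ≤ ‖kloosterman ψ' e'‖ := by
  classical
  induction j with
  | zero => exact ⟨F, _, _, _, ‹_›, ψ, e, hψ, hfrob, he, by simp, by simpa using hK⟩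
  | succ j ih =>
    obtain ⟨L, _, _, _, _, ψ', e', h1, h2, h3, h4, h5⟩ := ih
    have hL : ringChar L ≠ 2 := by rwa [ringChar.eq L p]
    obtain ⟨δ, hδ⟩ := FiniteField.exists_nonsquare hL
    have hfact : Fact (∀ r : L, r ^ 2 ≠ δ + 0 * r) := ⟨fun r hr => hδ ⟨r, by
      rw [zero_mul, add_zero] at hr
      rw [← hr, sq]⟩⟩
    have htwo : (2 : L) ≠ 0 := Ring.two_ne_zero hL
    have hchar : CharP (QuadraticAlgebra L δ 0) p := charP_of_injective_algebraMap
      (FaithfulSMul.algebraMap_injective L (QuadraticAlgebra L δ 0)) p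
    refine ⟨QuadraticAlgebra L δ 0, inferInstance, inferInstance, inferInstance, hchar,
      ψ'.compAddMonoidHom (QuadraticAlgebra.trace (R := L) (a := δ) (b := 0)).toAddMonoidHom,
      algebraMap L _ e', ?_, ?_, ?_, ?_, ?_⟩
    · obtain ⟨x, hx⟩ := AddChar.ne_one_iff.mp h1
      refine AddChar.ne_one_iff.mpr ⟨⟨x / 2, 0⟩, ?_⟩
      simp only [AddChar.compAddMonoidHom_apply, LinearMap.toAddMonoidHom_coe,
        QuadraticAlgebra.trace_def, zero_mul, add_zero]
      rwa [mul_div_cancel₀ _ htwo]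
    · intro x
      simp only [AddChar.compAddMonoidHom_apply, LinearMap.toAddMonoidHom_coe]
      rw [QuadraticAlgebra.trace_pow_char, h2]
    · rwa [Ne, map_eq_zero_iff _ (FaithfulSMul.algebraMap_injective L (QuadraticAlgebra L δ 0))]
    · rw [QuadraticAlgebra.card_eq, h4, ← pow_mul, pow_succ]
    · rw [kloosterman_quadraticAlgebra hL h1 h3 hδ, QuadraticAlgebra.card_eq]
      set q : ℝ := (Fintype.card L : ℝ) with hq
      have hq0 : 0 ≤ q := Nat.cast_nonneg _
      rw [Nat.cast_pow, Real.sqrt_sq hq0]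
      have h6 : ‖kloosterman ψ' e' ^ 2‖ - 2 * q ≤ ‖2 * (Fintype.card L : ℂ) -
          kloosterman ψ' e' ^ 2‖ := by
        have := norm_sub_norm_le (kloosterman ψ' e' ^ 2) (2 * (Fintype.card L : ℂ))
        rw [norm_sub_rev, norm_mul, Complex.norm_natCast, Complex.norm_ofNat] at this
        exact this
      refine le_trans ?_ h6
      have h7 : ((2 + 4 ^ j * ε) * √q) ^ 2 ≤ ‖kloosterman ψ' e'‖ ^ 2 :=
        pow_le_pow_left₀ (by positivity) h5 2
      rw [mul_pow, Real.sq_sqrt hq0] at h7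
      rw [norm_pow, pow_succ]
      -- With x = 4^j ε, (2 + x)²q - 2q = (2 + 4x + x²)q: the excess at least quadruples.
      nlinarith [mul_nonneg hq0 (sq_nonneg (4 ^ j * ε))]

/-- **Weil's bound for Kloosterman sums** in odd characteristic. -/
theorem norm_kloosterman_le {p : ℕ} [Fact p.Prime] (hp2 : p ≠ 2) {F : Type u} [Field F]
    [Fintype F] [DecidableEq F] [CharP F p] {ψ : AddChar F ℂ} (hψ : ψ ≠ 1)
    (hfrob : ∀ x, ψ (x ^ p) = ψ x) {e : F} (he : e ≠ 0) :
    ‖kloosterman ψ e‖ ≤ 2 * √(Fintype.card F) := by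
  by_contra! hlt
  have hq0 : 0 < √(Fintype.card F : ℝ) := Real.sqrt_pos.mpr (Nat.cast_pos.mpr Fintype.card_pos)
  set ε : ℝ := ‖kloosterman ψ e‖ / √(Fintype.card F) - 2 with hεd
  have hε : 0 < ε := by
    rw [hεd, sub_pos, lt_div_iff₀ hq0]
    exact hlt
  have hK : (2 + ε) * √(Fintype.card F) ≤ ‖kloosterman ψ e‖ := by
    rw [hεd, add_sub_cancel, div_mul_cancel₀ _ hq0.ne']
  obtain ⟨n, hn⟩ := pow_unbounded_of_one_lt (14 * p / ε) (by norm_num : (1 : ℝ) < 4)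
  -- The term `n` makes 4^n ε exceed 14p; `4 * p + 5` gives 2r + 1 = p^s > 4p + 5, so r is large
  -- enough for Stepanov. Using level `N + 1` makes the field order a square.
  set N := n + 4 * p + 5 with hN
  obtain ⟨L, _, _, _, _, ψ', e', h1, h2, h3, h4, h5⟩ :=
    exists_kloosterman_tower hp2 hψ hfrob he hε.le hK (N + 1)
  have hL : ringChar L ≠ 2 := by rwa [ringChar.eq L p]
  obtain ⟨a, -, ha⟩ := FiniteField.card F p
  have hcard : Fintype.card L = (p ^ ((a : ℕ) * 2 ^ N)) ^ 2 := by
    rw [h4, ha, ← pow_mul, ← pow_mul, pow_succ, mul_assoc]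
  set s := (a : ℕ) * 2 ^ N with hs
  have hodd : Odd (p ^ s) := ((Fact.out : p.Prime).odd_of_ne_two hp2).pow
  obtain ⟨r, hr⟩ := hodd
  have hNs : N ≤ s := by
    have h6 : N < 2 ^ N := Nat.lt_two_pow_self
    have h7 : 1 ≤ (a : ℕ) := a.pos
    nlinarith
  have hsP : s < p ^ s := Nat.lt_pow_self (Fact.out : p.Prime).one_lt
  have h6 := norm_kloosterman_le_of_card_eq_sq hL h1 h2 h3 hr hcard (by omega)
  rw [hcard, Nat.cast_pow, Real.sqrt_sq (Nat.cast_nonneg _)] at h5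
  have hP0 : (0 : ℝ) < (p ^ s : ℕ) := by exact_mod_cast (by omega : 0 < p ^ s)
  have h7 := le_of_mul_le_mul_right (h5.trans h6) hP0
  rw [div_lt_iff₀ hε] at hn
  have h8 : (4 : ℝ) ^ n ≤ 4 ^ (N + 1) := pow_le_pow_right₀ (by norm_num) (by omega)
  nlinarith

end WeilBound

/-! ### Gauss, Salié and twisted Kloosterman sums. -/

section GaussSalie

universe u

variable {F : Type u} [Field F] [Fintype F] [DecidableEq F]

theorem quadChar_mul (a b : F) : quadChar (a * b) = quadChar a * quadChar b := by
  rw [quadChar, map_mul, Int.cast_mul]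
  rfl

theorem quadChar_mul_self {a : F} (ha : a ≠ 0) : quadChar a * quadChar a = 1 := by
  rcases quadraticChar_dichotomy ha with h | h <;> simp [quadChar, h]

theorem norm_quadChar {a : F} (ha : a ≠ 0) : ‖quadChar a‖ = 1 := by
  rcases quadraticChar_dichotomy ha with h | h <;> simp [quadChar, h]

theorem quadChar_inv {a : F} (ha : a ≠ 0) : quadChar a⁻¹ = quadChar a := by
  have h1 : quadChar a⁻¹ * quadChar a = 1 := by
    rw [← quadChar_mul, inv_mul_cancel₀ ha]
    simp [quadChar]
  calc quadChar a⁻¹ = quadChar a⁻¹ * (quadChar a * quadChar a) := by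
        rw [quadChar_mul_self ha, mul_one]
    _ = quadChar a := by rw [← mul_assoc, h1, one_mul]

/-- The quadratic Gauss sum. -/
def quadGauss (ψ : AddChar F ℂ) : ℂ := ∑ x, quadChar x * ψ x

theorem norm_quadGauss (hF : ringChar F ≠ 2) {ψ : AddChar F ℂ} (hψ : ψ ≠ 1) :
    ‖quadGauss ψ‖ = √(Fintype.card F) := by
  have h1 := gaussSum_sq (χ := (quadraticChar F).ringHomComp (Int.castRingHom ℂ))
    ((MulChar.ringHomComp_ne_one_iff (RingHom.injective_int _)).mpr (quadraticChar_ne_one hF))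
    ((quadraticChar_isQuadratic F).comp _) (AddChar.IsPrimitive.of_ne_one hψ)
  have h2 : gaussSum ((quadraticChar F).ringHomComp (Int.castRingHom ℂ)) ψ = quadGauss ψ := rfl
  rw [h2] at h1
  have h3 := congrArg norm h1
  rw [norm_pow, norm_mul, Complex.norm_natCast] at h3
  have h4 : ‖(quadraticChar F).ringHomComp (Int.castRingHom ℂ) (-1)‖ = 1 :=
    norm_quadChar (neg_ne_zero.mpr one_ne_zero)
  rw [h4, one_mul] at h3
  rw [← h3, Real.sqrt_sq (norm_nonneg _)]

theorem sum_quadChar_mul_shift (ψ : AddChar F ℂ) {a : F} (ha : a ≠ 0) :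
    ∑ x, quadChar x * ψ (a * x) = quadChar a * quadGauss ψ := by
  rw [quadGauss, Finset.mul_sum, ← Equiv.sum_comp (Equiv.mulLeft₀ a ha)
    (fun x => quadChar a * (quadChar x * ψ x))]
  refine Finset.sum_congr rfl fun x _ => ?_
  simp only [Equiv.mulLeft₀_apply, quadChar_mul]
  linear_combination (-quadChar x * ψ (a * x)) * quadChar_mul_self ha

theorem sum_addChar_mul_sq (hF : ringChar F ≠ 2) {ψ : AddChar F ℂ} (hψ : ψ ≠ 1) {a : F}
    (ha : a ≠ 0) : ∑ x, ψ (a * x ^ 2) = quadChar a * quadGauss ψ := by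
  rw [Finset.sum_comp_eq_sum_card_mul _ (fun x : F => x ^ 2) (fun s => ψ (a * s))]
  simp only [card_sq_eq hF, add_mul, one_mul, Finset.sum_add_distrib]
  have h1 : ∑ x, ψ (a * x) = 0 := by
    have := AddChar.sum_mulShift (ψ := ψ) a (AddChar.IsPrimitive.of_ne_one hψ)
    simpa [ha, mul_comm] using this
  rw [h1, zero_add, sum_quadChar_mul_shift ψ ha]

/-- Completing the square in a quadratic exponential sum. -/
theorem sum_addChar_quadratic (hF : ringChar F ≠ 2) {ψ : AddChar F ℂ} (hψ : ψ ≠ 1) {a : F}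
    (ha : a ≠ 0) (m : F) :
    ∑ x, ψ (a * x ^ 2 + m * x) = quadChar a * quadGauss ψ * ψ (-(m ^ 2 / (4 * a))) := by
  have h2 : (2 : F) ≠ 0 := Ring.two_ne_zero hF
  have h4 : (4 : F) ≠ 0 := by rw [show (4 : F) = 2 * 2 by norm_num]; exact mul_ne_zero h2 h2
  rw [← sum_addChar_mul_sq hF hψ ha, Finset.sum_mul,
    ← Equiv.sum_comp (Equiv.addRight (m / (2 * a))) (fun x => ψ (a * x ^ 2) * _)]
  refine Finset.sum_congr rfl fun x _ => ?_
  rw [← AddChar.map_add_eq_mul, Equiv.coe_addRight]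
  congr 1
  field_simp
  ring

theorem sum_ne_zero_addChar_mul {ψ : AddChar F ℂ} (hψ : ψ ≠ 1) (a : F) :
    ∑ s : F, (if s = 0 then 0 else ψ (s * a)) = (if a = 0 then (Fintype.card F : ℂ) else 0) - 1 := by
  have h1 := AddChar.sum_mulShift (ψ := ψ) a (AddChar.IsPrimitive.of_ne_one hψ)
  rw [← Finset.add_sum_erase _ _ (Finset.mem_univ (0 : F))] at h1 ⊢
  have h2 : ∑ s ∈ Finset.univ.erase (0 : F), (if s = 0 then 0 else ψ (s * a)) =
      ∑ s ∈ Finset.univ.erase (0 : F), ψ (s * a) :=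
    Finset.sum_congr rfl fun s hs => if_neg (Finset.ne_of_mem_erase hs)
  rw [h2, if_pos rfl, zero_add, eq_sub_iff_add_eq, add_comm]
  rw [zero_mul, AddChar.map_zero_eq_one] at h1
  rw [h1]
  push_cast
  rfl

theorem one_le_sqrt_card {F : Type*} [Fintype F] [Nonempty F] : 1 ≤ √(Fintype.card F : ℝ) := by
  rw [Real.one_le_sqrt]
  exact_mod_cast Fintype.card_pos

/-- The bound for Salié sums. -/
theorem norm_salie_le (hF : ringChar F ≠ 2) {ψ : AddChar F ℂ} (hψ : ψ ≠ 1) (a : F) {b : F}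
    (hb : b ≠ 0) :
    ‖∑ x : F, (if x = 0 then 0 else quadChar x * ψ (a * x + b * x⁻¹))‖ ≤
      2 * √(Fintype.card F) := by
  have h2 : (2 : F) ≠ 0 := Ring.two_ne_zero hF
  have h4 : (4 : F) ≠ 0 := by rw [show (4 : F) = 2 * 2 by norm_num]; exact mul_ne_zero h2 h2
  set S := ∑ x : F, (if x = 0 then 0 else quadChar x * ψ (a * x + b * x⁻¹)) with hS
  set q : ℝ := (Fintype.card F : ℝ) with hq
  have hq0 : 0 < √q := Real.sqrt_pos.mpr (Nat.cast_pos.mpr Fintype.card_pos)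
  -- Completing the square backwards writes χ(-x/b) G ψ(b/x), G being the Gauss sum, as Σ_y
  -- ψ(-(x/b)y² + 2y). The sum over x then detects y² = ab, which has at most two solutions.
  have key : quadChar (-b) * quadGauss ψ * S =
      ∑ y, ψ (2 * y) * (if a - y ^ 2 / b = 0 then (Fintype.card F : ℂ) else 0) := by
    have h5 : ∑ y : F, ψ (2 * y) = 0 := by
      have := AddChar.sum_mulShift (ψ := ψ) 2 (AddChar.IsPrimitive.of_ne_one hψ)
      simpa [h2, mul_comm] using this
    calc quadChar (-b) * quadGauss ψ * S
        = ∑ x : F, ∑ y : F, ψ (2 * y) * (if x = 0 then 0 else ψ (x * (a - y ^ 2 / b))) := by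
          rw [hS, Finset.mul_sum]
          refine Finset.sum_congr rfl fun x _ => ?_
          by_cases hx : x = 0
          · simp [hx]
          simp only [if_neg hx]
          have hxb : -(x / b) ≠ 0 := neg_ne_zero.mpr (div_ne_zero hx hb)
          have h6 := sum_addChar_quadratic hF hψ hxb 2
          have h7 : quadChar (-(x / b)) = quadChar (-b) * quadChar x := by
            rw [show -(x / b) = (-b)⁻¹ * x by field_simp, quadChar_mul,
              quadChar_inv (neg_ne_zero.mpr hb)]
          have h8 : -((2 : F) ^ 2 / (4 * -(x / b))) = b * x⁻¹ := by
            field_simp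
            norm_num
          rw [h7, h8] at h6
          have h9 : ∀ y, ψ (2 * y) * ψ (x * (a - y ^ 2 / b)) =
              ψ (a * x) * ψ (-(x / b) * y ^ 2 + 2 * y) := by
            intro y
            rw [← AddChar.map_add_eq_mul, ← AddChar.map_add_eq_mul]
            congr 1
            field_simp
            ring
          simp only [h9]
          rw [← Finset.mul_sum, h6, AddChar.map_add_eq_mul]
          ring
      _ = ∑ y, ψ (2 * y) * ((if a - y ^ 2 / b = 0 then (Fintype.card F : ℂ) else 0) - 1) := by
          rw [Finset.sum_comm]
          refine Finset.sum_congr rfl fun y _ => ?_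
          rw [← Finset.mul_sum, sum_ne_zero_addChar_mul hψ]
      _ = _ := by
          simp only [mul_sub, mul_one, Finset.sum_sub_distrib, h5, sub_zero]
  have hfew : ((Finset.univ.filter fun t : F => t ^ 2 = a * b).card : ℝ) ≤ 2 := by
    have h1 := card_sq_eq hF (a * b)
    have h2 : ‖((Finset.univ.filter fun t : F => t ^ 2 = a * b).card : ℂ)‖ ≤ 2 := by
      rw [h1]
      refine (norm_add_le _ _).trans ?_
      rw [norm_one]
      linarith [norm_quadChar_le (a * b)]
    simpa using h2
  have h3 : √q * ‖S‖ ≤ √q * (2 * √q) := by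
    calc √q * ‖S‖ = ‖quadChar (-b) * quadGauss ψ * S‖ := by
          rw [norm_mul, norm_mul, norm_quadChar (neg_ne_zero.mpr hb), norm_quadGauss hF hψ, one_mul]
      _ ≤ ∑ y : F, if y ^ 2 = a * b then q else 0 := by
          rw [key]
          refine (norm_sum_le _ _).trans (Finset.sum_le_sum fun y _ => ?_)
          rw [norm_mul, AddChar.norm_apply, one_mul]
          have hiff : a - y ^ 2 / b = 0 ↔ y ^ 2 = a * b := by
            rw [sub_eq_zero, eq_div_iff hb, eq_comm]
          simp only [hiff]
          split_ifs
          · rw [Complex.norm_natCast]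
          · simp
      _ = (Finset.univ.filter fun t : F => t ^ 2 = a * b).card * q := by
          rw [← Finset.sum_filter, Finset.sum_const, nsmul_eq_mul]
      _ ≤ 2 * q := by gcongr
      _ = √q * (2 * √q) := by
          rw [mul_left_comm, Real.mul_self_sqrt (Nat.cast_nonneg _)]
  exact le_of_mul_le_mul_left h3 hq0

/-- The common bound for Kloosterman, Salié and Ramanujan sums. -/
theorem norm_twisted_kloosterman_le {p : ℕ} [Fact p.Prime] [CharP F p] (hp2 : p ≠ 2)
    {ψ : AddChar F ℂ} (hψ : ψ ≠ 1) (hfrob : ∀ x, ψ (x ^ p) = ψ x) (d : ℕ) {a : F} (ha : a ≠ 0)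
    (b : F) :
    ‖∑ s : F, (if s = 0 then 0 else quadChar s ^ d * ψ (a * s + b * s⁻¹))‖ ≤
      2 * √(Fintype.card F) := by
  have hF : ringChar F ≠ 2 := by rwa [ringChar.eq F p]
  have h1 := one_le_sqrt_card (F := F)
  -- Even `d` gives a Kloosterman sum, or -1 if b = 0; odd `d` gives a Salié sum, or a Gauss sum if
  -- b = 0.
  rcases Nat.even_or_odd' d with ⟨l, rfl | rfl⟩
  · have hone : ∀ s : F, (if s = 0 then 0 else quadChar s ^ (2 * l) * ψ (a * s + b * s⁻¹)) =
        if s = 0 then 0 else ψ (a * s + b * s⁻¹) := by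
      intro s
      by_cases hs : s = 0
      · simp [hs]
      · rw [if_neg hs, if_neg hs, pow_mul, sq, quadChar_mul_self hs, one_pow, one_mul]
    simp only [hone]
    by_cases hb : b = 0
    · have h2 := sum_ne_zero_addChar_mul hψ a
      simp only [hb, zero_mul, add_zero, mul_comm a]
      rw [h2, if_neg ha, zero_sub, norm_neg, norm_one]
      linarith
    · have h2 : ∑ s : F, (if s = 0 then 0 else ψ (a * s + b * s⁻¹)) = kloosterman ψ (a * b) := by
        rw [kloosterman, ← Equiv.sum_comp (Equiv.mulLeft₀ a ha)
          (fun x => if x = 0 then 0 else ψ (x + a * b * x⁻¹))]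
        refine Finset.sum_congr rfl fun s _ => ?_
        simp only [Equiv.mulLeft₀_apply, mul_eq_zero, ha, false_or]
        split_ifs with hs
        · rfl
        · congr 1
          field_simp
      rw [h2]
      exact norm_kloosterman_le hp2 hψ hfrob (mul_ne_zero ha hb)
  · have hone : ∀ s : F, (if s = 0 then 0 else quadChar s ^ (2 * l + 1) * ψ (a * s + b * s⁻¹)) =
        if s = 0 then 0 else quadChar s * ψ (a * s + b * s⁻¹) := by
      intro s
      by_cases hs : s = 0
      · simp [hs]
      · rw [if_neg hs, if_neg hs, pow_succ, pow_mul, sq, quadChar_mul_self hs, one_pow, one_mul]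
    simp only [hone]
    by_cases hb : b = 0
    · have h2 : ∑ s : F, (if s = 0 then 0 else quadChar s * ψ (a * s + b * s⁻¹)) =
          quadChar a * quadGauss ψ := by
        rw [← sum_quadChar_mul_shift ψ ha]
        refine Finset.sum_congr rfl fun s _ => ?_
        split_ifs with hs
        · simp [hs, quadChar]
        · simp [hb]
      rw [h2, norm_mul, norm_quadChar ha, norm_quadGauss hF hψ]
      linarith
    · exact norm_salie_le hF hψ a hb

end GaussSalie

/-! ### Fourier analysis of spheres and the distance estimate. -/

section Sphere

universe u

theorem AddChar.map_sum_eq_prod' {ι F : Type*} [Field F] (ψ : AddChar F ℂ) (s : Finset ι) (f : ι → F) :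
    ψ (∑ i ∈ s, f i) = ∏ i ∈ s, ψ (f i) := by
  classical
  induction s using Finset.induction_on with
  | empty => simp
  | insert i s hi ih => rw [Finset.sum_insert hi, Finset.prod_insert hi, AddChar.map_add_eq_mul, ih]

variable {F : Type u} [Field F] [Fintype F] [DecidableEq F]

/-- A nontrivial character of the prime field composed with the absolute trace, which Frobenius
preserves. -/
theorem exists_addChar_frobenius_invariant (F : Type*) [Field F] [Finite F] (p : ℕ)
    [Fact p.Prime] [CharP F p] : ∃ ψ : AddChar F ℂ, ψ ≠ 1 ∧ ∀ x, ψ (x ^ p) = ψ x := by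
  let _ : Algebra (ZMod p) F := ZMod.algebra F p
  refine ⟨ZMod.stdAddChar.compAddMonoidHom (Algebra.trace (ZMod p) F).toAddMonoidHom, ?_, ?_⟩
  · obtain ⟨a, ha⟩ := AddChar.ne_one_iff.mp
      ((ZMod.isPrimitive_stdAddChar p) (one_ne_zero (α := ZMod p)))
    obtain ⟨x, hx⟩ := Algebra.trace_surjective (ZMod p) F a
    refine AddChar.ne_one_iff.mpr ⟨x, ?_⟩
    simpa [hx] using ha
  · intro x
    have h1 := Algebra.trace_eq_of_algEquiv (FiniteField.frobeniusAlgEquivOfAlgebraic (ZMod p) F) x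
    simp only [FiniteField.coe_frobeniusAlgEquivOfAlgebraic, ZMod.card] at h1
    simp [h1]

theorem sum_addChar_sum_eq_prod {F : Type*} [Field F] [Fintype F] {d : ℕ} (ψ : AddChar F ℂ) (f : Fin d → F → F) :
    ∑ z : Fin d → F, ψ (∑ i, f i (z i)) = ∏ i, ∑ x : F, ψ (f i x) := by
  simp only [AddChar.map_sum_eq_prod']
  rw [Finset.prod_univ_sum, Fintype.piFinset_univ]

theorem sum_addChar_dotProduct {d : ℕ} {ψ : AddChar F ℂ} (hψ : ψ ≠ 1) (w : Fin d → F) :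
    ∑ m : Fin d → F, ψ (m ⬝ᵥ w) = if w = 0 then (Fintype.card F : ℂ) ^ d else 0 := by
  have h1 := sum_addChar_sum_eq_prod (d := d) ψ (fun i x => x * w i)
  simp only [AddChar.sum_mulShift _ (AddChar.IsPrimitive.of_ne_one hψ)] at h1
  simp only [dotProduct]
  rw [h1]
  split_ifs with hw
  · simp [hw]
  · obtain ⟨i, hi⟩ := Function.ne_iff.mp hw
    exact Finset.prod_eq_zero (Finset.mem_univ i) (by simpa using hi)

/-- The Fourier coefficients of the centred indicator function of a sphere of nonzero radius. -/
theorem norm_fourier_sphere_le {p : ℕ} [Fact p.Prime] [CharP F p] (hp2 : p ≠ 2)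
    {ψ : AddChar F ℂ} (hψ : ψ ≠ 1) (hfrob : ∀ x, ψ (x ^ p) = ψ x) {d : ℕ} {t : F} (ht : t ≠ 0)
    (m : Fin d → F) :
    ‖∑ z : Fin d → F, ((if ffLength z = t then (Fintype.card F : ℂ) else 0) - 1) * ψ (m ⬝ᵥ z)‖ ≤
      2 * √(Fintype.card F) ^ (d + 1) := by
  have hF : ringChar F ≠ 2 := by rwa [ringChar.eq F p]
  -- The centred indicator is a sum over nonzero frequencies s. For fixed s the sum over z factors
  -- into d one-variable Gaussians, each giving χ(s), a Gauss sum and a phase in 1/s.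
  have key : ∑ z : Fin d → F, ((if ffLength z = t then (Fintype.card F : ℂ) else 0) - 1) *
      ψ (m ⬝ᵥ z) = quadGauss ψ ^ d * ∑ s : F, (if s = 0 then 0 else
        quadChar s ^ d * ψ (-t * s + -(ffLength m / 4) * s⁻¹)) := by
    calc _ = ∑ z : Fin d → F, ∑ s : F, (if s = 0 then 0 else
          ψ (s * (ffLength z - t)) * ψ (m ⬝ᵥ z)) := by
          refine Finset.sum_congr rfl fun z _ => ?_
          have := sum_ne_zero_addChar_mul hψ (ffLength z - t)
          simp only [sub_eq_zero] at this
          rw [← this, Finset.sum_mul]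
          refine Finset.sum_congr rfl fun s _ => ?_
          rw [ite_mul, zero_mul]
      _ = ∑ s : F, ∑ z : Fin d → F, (if s = 0 then 0 else
          ψ (s * (ffLength z - t)) * ψ (m ⬝ᵥ z)) := Finset.sum_comm
      _ = _ := by
          rw [Finset.mul_sum]
          refine Finset.sum_congr rfl fun s _ => ?_
          by_cases hs : s = 0
          · simp [hs]
          simp only [if_neg hs]
          have h1 := sum_addChar_sum_eq_prod (d := d) ψ (fun i x => s * x ^ 2 + m i * x)
          simp only [sum_addChar_quadratic hF hψ hs, Finset.prod_mul_distrib, Finset.prod_const,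
            Finset.card_univ, Fintype.card_fin, ← AddChar.map_sum_eq_prod'] at h1
          have h2 : ∀ z : Fin d → F, ψ (s * (ffLength z - t)) * ψ (m ⬝ᵥ z) =
              ψ (-t * s) * ψ (∑ i, (s * z i ^ 2 + m i * z i)) := by
            intro z
            rw [← AddChar.map_add_eq_mul, ← AddChar.map_add_eq_mul, Finset.sum_add_distrib,
              ← Finset.mul_sum]
            congr 1
            simp only [ffLength, dotProduct]
            ring
          have h3 : ∑ i, -(m i ^ 2 / (4 * s)) = -(ffLength m / 4) * s⁻¹ := by
            rw [Finset.sum_neg_distrib, ← Finset.sum_div, ffLength]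
            rw [← div_div, div_eq_mul_inv _ s, neg_mul]
          simp only [h2]
          rw [← Finset.mul_sum, h1, h3, AddChar.map_add_eq_mul]
          ring
  rw [key, norm_mul, norm_pow, norm_quadGauss hF hψ, pow_succ, ← mul_assoc, mul_comm 2, mul_assoc]
  exact mul_le_mul_of_nonneg_left
    (norm_twisted_kloosterman_le hp2 hψ hfrob d (neg_ne_zero.mpr ht) _) (by positivity)

/-- A bilinear form whose kernel has small Fourier coefficients is small. -/
theorem norm_sum_kernel_le {d : ℕ} {ψ : AddChar F ℂ} (hψ : ψ ≠ 1) {B : ℝ} (K : (Fin d → F) → ℂ)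
    (hK : ∀ m, ‖∑ z, K z * ψ (m ⬝ᵥ z)‖ ≤ B) (E : Finset (Fin d → F)) :
    ‖∑ x ∈ E, ∑ y ∈ E, K (x - y)‖ ≤ B * E.card := by
  set Q : ℂ := (Fintype.card F : ℂ) ^ d with hQ
  have hQn : 0 < ‖Q‖ := by
    rw [hQ, norm_pow, Complex.norm_natCast]
    exact pow_pos (Nat.cast_pos.mpr Fintype.card_pos) _
  set e : (Fin d → F) → ℂ := fun m => ∑ x ∈ E, ψ (m ⬝ᵥ x) with he
  set e' : (Fin d → F) → ℂ := fun m => ∑ x ∈ E, ψ (-(m ⬝ᵥ x)) with he'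
  have hconj : ∀ m, e' m = starRingEnd ℂ (e m) := by
    intro m
    simp only [he, he', map_sum, AddChar.map_neg_eq_conj]
  have hpars : ∑ m, e m * e' m = Q * E.card := by
    calc ∑ m, e m * e' m = ∑ m, ∑ x ∈ E, ∑ y ∈ E, ψ (m ⬝ᵥ (x - y)) := by
          refine Finset.sum_congr rfl fun m _ => ?_
          rw [he, he', Finset.sum_mul_sum]
          refine Finset.sum_congr rfl fun x _ => Finset.sum_congr rfl fun y _ => ?_
          rw [← AddChar.map_add_eq_mul, dotProduct_sub, sub_eq_add_neg]
      _ = ∑ x ∈ E, ∑ y ∈ E, if x = y then Q else 0 := by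
          rw [Finset.sum_comm]
          refine Finset.sum_congr rfl fun x _ => ?_
          rw [Finset.sum_comm]
          refine Finset.sum_congr rfl fun y _ => ?_
          rw [sum_addChar_dotProduct hψ]
          simp only [sub_eq_zero]
          rfl
      _ = Q * E.card := by
          simp [Finset.sum_ite_eq, mul_comm]
  -- Characters diagonalise the form: the Fourier coefficients of `K` are weighted by |e m|², of
  -- total mass `Q * E.card` by `hpars`.
  have hmain : ∑ m, (∑ z, K z * ψ (m ⬝ᵥ z)) * (e' m * e m) =
      Q * ∑ x ∈ E, ∑ y ∈ E, K (x - y) := by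
    calc ∑ m, (∑ z, K z * ψ (m ⬝ᵥ z)) * (e' m * e m)
        = ∑ m, ∑ x ∈ E, ∑ y ∈ E, ∑ z, K z * ψ (m ⬝ᵥ (z - (x - y))) := by
          refine Finset.sum_congr rfl fun m _ => ?_
          rw [he, he', Finset.sum_mul_sum, Finset.mul_sum]
          refine Finset.sum_congr rfl fun x _ => ?_
          rw [Finset.mul_sum]
          refine Finset.sum_congr rfl fun y _ => ?_
          rw [Finset.sum_mul]
          refine Finset.sum_congr rfl fun z _ => ?_
          rw [mul_assoc, ← AddChar.map_add_eq_mul, ← AddChar.map_add_eq_mul, dotProduct_sub,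
            dotProduct_sub]
          congr 2
          ring
      _ = ∑ x ∈ E, ∑ y ∈ E, ∑ z, K z * (if z = x - y then Q else 0) := by
          rw [Finset.sum_comm]
          refine Finset.sum_congr rfl fun x _ => ?_
          rw [Finset.sum_comm]
          refine Finset.sum_congr rfl fun y _ => ?_
          rw [Finset.sum_comm]
          refine Finset.sum_congr rfl fun z _ => ?_
          rw [← Finset.mul_sum, sum_addChar_dotProduct hψ]
          simp only [sub_eq_zero]
          rfl
      _ = _ := by
          simp only [mul_ite, mul_zero, Finset.sum_ite_eq', Finset.mem_univ, if_true,
            Finset.mul_sum]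
          simp only [mul_comm]
  have hnorm : ‖Q‖ * ‖∑ x ∈ E, ∑ y ∈ E, K (x - y)‖ ≤ ‖Q‖ * (B * E.card) := by
    have hsq : ∀ m, ‖e' m * e m‖ = (e m * e' m).re := by
      intro m
      rw [hconj, mul_comm, norm_mul, RCLike.norm_conj, Complex.mul_conj, Complex.ofReal_re,
        Complex.normSq_eq_norm_sq, sq]
    calc ‖Q‖ * ‖∑ x ∈ E, ∑ y ∈ E, K (x - y)‖
        = ‖∑ m, (∑ z, K z * ψ (m ⬝ᵥ z)) * (e' m * e m)‖ := by rw [hmain, norm_mul]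
      _ ≤ ∑ m, B * (e m * e' m).re := by
          refine (norm_sum_le _ _).trans (Finset.sum_le_sum fun m _ => ?_)
          rw [norm_mul, ← hsq]
          exact mul_le_mul_of_nonneg_right (hK m) (norm_nonneg _)
      _ = B * (Q * E.card).re := by rw [← Finset.mul_sum, ← hpars, Complex.re_sum]
      _ = ‖Q‖ * (B * E.card) := by
          have : (Q * E.card).re = ‖Q‖ * E.card := by
            rw [hQ, norm_pow, Complex.norm_natCast]
            norm_cast
          rw [this]; ring
  exact le_of_mul_le_mul_left hnorm hQn

/-- The **Iosevich–Rudnev estimate** for the number of pairs at a given nonzero distance. -/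
theorem abs_card_pairs_sub_le (hF : ringChar F ≠ 2) {d : ℕ} {t : F} (ht : t ≠ 0)
    (E : Finset (Fin d → F)) :
    |(Fintype.card F : ℝ) * ∑ x ∈ E, ((E.filter fun y => ffLength (x - y) = t).card : ℝ) -
      (E.card : ℝ) ^ 2| ≤ 2 * √(Fintype.card F) ^ (d + 1) * E.card := by
  obtain ⟨p, hp⟩ := CharP.exists F
  have hprime : Fact p.Prime := ⟨CharP.char_is_prime F p⟩
  have hp2 : p ≠ 2 := by rwa [← ringChar.eq F p]
  obtain ⟨ψ, hψ, hfrob⟩ := exists_addChar_frobenius_invariant F p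
  have h1 := norm_sum_kernel_le hψ
    (fun z : Fin d → F => (if ffLength z = t then (Fintype.card F : ℂ) else 0) - 1)
    (norm_fourier_sphere_le hp2 hψ hfrob ht) E
  have h2 : ∑ x ∈ E, ∑ y ∈ E, ((if ffLength (x - y) = t then (Fintype.card F : ℂ) else 0) - 1) =
      (((Fintype.card F : ℝ) * ∑ x ∈ E, ((E.filter fun y => ffLength (x - y) = t).card : ℝ) -
        (E.card : ℝ) ^ 2 : ℝ) : ℂ) := by
    simp only [Finset.sum_sub_distrib, ← Finset.sum_filter, Finset.sum_const, nsmul_eq_mul]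
    push_cast
    rw [← Finset.sum_mul]
    ring
  rwa [h2, Complex.norm_real, Real.norm_eq_abs] at h1

end Sphere

/-! ### Degrees in the distance graph and the choice of constants. -/

section DistanceGraph

variable {F : Type*} [Field F] {d : ℕ}

theorem ffDistanceGraph_isContained_of_subset {E E' : Set (Fin d → F)} (h : E' ⊆ E) (t : F) :
    (ffDistanceGraph E' t).IsContained (ffDistanceGraph E t) :=
  ⟨⟨⟨Set.inclusion h, fun hxy =>
    ⟨fun he => hxy.1 (Set.inclusion_injective h he), hxy.2⟩⟩, Set.inclusion_injective h⟩⟩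

theorem degree_ffDistanceGraph [DecidableEq F] (E : Finset (Fin d → F)) {t : F} (ht : t ≠ 0)
    [DecidableRel (ffDistanceGraph (E : Set (Fin d → F)) t).Adj]
    (x : (E : Set (Fin d → F))) :
    (ffDistanceGraph (E : Set (Fin d → F)) t).degree x =
      (E.filter fun y => ffLength ((x : Fin d → F) - y) = t).card := by
  rw [← SimpleGraph.card_neighborFinset_eq_degree]
  refine Finset.card_bij (fun y _ => (y : Fin d → F)) ?_ (fun y _ z _ h => Subtype.ext h) ?_
  · intro y hy
    rw [SimpleGraph.mem_neighborFinset] at hy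
    exact Finset.mem_filter.mpr ⟨y.2, hy.2⟩
  · intro y hy
    rw [Finset.mem_filter] at hy
    refine ⟨⟨y, hy.1⟩, ?_, rfl⟩
    rw [SimpleGraph.mem_neighborFinset]
    refine ⟨?_, hy.2⟩
    intro hxy
    apply ht
    rw [← hy.2, hxy]
    simp [ffLength]

variable [Fintype F] [DecidableEq F]

/-- The pair estimate only controls average degrees. Markov's inequality discards at most half of
the points, those of large degree, and the estimate applied again to the remaining set keeps its
average degree large. -/
theorem exists_subset_degree_bounds (hF : ringChar F ≠ 2) {t : F} (ht : t ≠ 0)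
    (E : Finset (Fin d → F)) (hE : 8 * √(Fintype.card F) ^ (d + 1) ≤ E.card) :
    ∃ E' ⊆ E, (E.card : ℝ) ≤ 2 * E'.card ∧
      (∀ x ∈ E', (Fintype.card F : ℝ) * ((E'.filter fun y => ffLength (x - y) = t).card : ℝ) ≤
        4 * E.card) ∧
      (E.card : ℝ) / 4 * E'.card ≤
        (Fintype.card F : ℝ) * ∑ x ∈ E', ((E'.filter fun y => ffLength (x - y) = t).card : ℝ) := by
  set q : ℝ := (Fintype.card F : ℝ)
  set n : ℝ := (E.card : ℝ) with hn
  set f : (Fin d → F) → ℝ := fun x => ((E.filter fun y => ffLength (x - y) = t).card : ℝ) with hf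
  have hn0 : 0 ≤ n := Nat.cast_nonneg _
  have hq0 : 0 ≤ q := Nat.cast_nonneg _
  set E' := E.filter fun x => q * f x ≤ 4 * n with hE'
  have hsub : E' ⊆ E := Finset.filter_subset _ _
  have h1 := (abs_le.mp (abs_card_pairs_sub_le hF ht E)).2
  have h2 := (abs_le.mp (abs_card_pairs_sub_le hF ht E')).1
  have hsplit : (E'.card : ℝ) + ((E.filter fun x => ¬ q * f x ≤ 4 * n).card : ℝ) = n := by
    rw [hE', ← Nat.cast_add, Finset.card_filter_add_card_filter_not]
  have hmarkov : (4 * n) * ((E.filter fun x => ¬ q * f x ≤ 4 * n).card : ℝ) ≤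
      q * ∑ x ∈ E, f x := by
    rw [Finset.mul_sum, mul_comm, ← nsmul_eq_mul, ← Finset.sum_const]
    refine (Finset.sum_le_sum fun x hx => (not_le.mp (Finset.mem_filter.mp hx).2).le).trans ?_
    exact Finset.sum_le_sum_of_subset_of_nonneg (Finset.filter_subset _ _)
      fun x _ _ => mul_nonneg hq0 (Nat.cast_nonneg _)
  have hhalf : n ≤ 2 * E'.card := by
    rcases hn0.eq_or_lt with h0 | h0
    · rw [← h0]; positivity
    have h3 : (4 * n) * ((E.filter fun x => ¬ q * f x ≤ 4 * n).card : ℝ) ≤ 2 * n * n := by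
      refine hmarkov.trans ?_
      have h4 : 0 ≤ √q ^ (d + 1) := pow_nonneg (Real.sqrt_nonneg q) (d + 1)
      have h5 : 2 * √q ^ (d + 1) * n ≤ n * n := mul_le_mul_of_nonneg_right (by linarith) hn0
      change q * ∑ x ∈ E, f x - n ^ 2 ≤ 2 * √q ^ (d + 1) * n at h1
      nlinarith
    have h4 : 2 * ((E.filter fun x => ¬ q * f x ≤ 4 * n).card : ℝ) ≤ n :=
      le_of_mul_le_mul_left (by linarith) (by linarith : 0 < 2 * n)
    linarith
  refine ⟨E', hsub, hhalf, fun x hx => ?_, ?_⟩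
  · refine le_trans (mul_le_mul_of_nonneg_left ?_ hq0) (Finset.mem_filter.mp hx).2
    exact Nat.cast_le.mpr (Finset.card_le_card (Finset.filter_subset_filter _ hsub))
  · have hn'0 : (0 : ℝ) ≤ E'.card := Nat.cast_nonneg _
    have h3 : 2 * √q ^ (d + 1) * E'.card ≤ n / 4 * E'.card :=
      mul_le_mul_of_nonneg_right (by linarith) hn'0
    nlinarith [mul_le_mul_of_nonneg_right hhalf hn'0]

/-- Even cycles of length `2k` occur in the `t`-distance graph of every sufficiently large set. -/
theorem cycleGraph_isContained_ffDistanceGraph {k : ℕ} (hk : 2 ≤ k) (hF : ringChar F ≠ 2)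
    (hdk : 2 * k ≤ (d + 1) * (k - 1)) {t : F} (ht : t ≠ 0) (E : Finset (Fin d → F))
    (hE : (256 * (k : ℝ) ^ 2) ^ k * √(Fintype.card F) ^ (d + 1) < E.card) :
    (SimpleGraph.cycleGraph (2 * k)).IsContained (ffDistanceGraph (E : Set (Fin d → F)) t) := by
  classical
  set q : ℝ := (Fintype.card F : ℝ) with hq
  set n : ℝ := (E.card : ℝ) with hn
  set w : ℝ := √q ^ (d + 1) with hw
  set c : ℝ := (256 * (k : ℝ) ^ 2) ^ k with hc
  have hq1 : 1 ≤ q := by rw [hq]; exact_mod_cast Fintype.card_pos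
  have hq0 : 0 < q := by linarith
  have hw0 : 0 < w := pow_pos (Real.sqrt_pos.mpr hq0) _
  have hk1 : (1 : ℝ) ≤ k := by exact_mod_cast (by omega : 1 ≤ k)
  have hc8 : 8 ≤ c := by
    have h1 : (256 : ℝ) ≤ 256 * (k : ℝ) ^ 2 := by nlinarith
    have h2 : 256 * (k : ℝ) ^ 2 ≤ c := le_self_pow₀ (by linarith) (by omega)
    linarith
  have hn0 : 0 < n := lt_of_le_of_lt (by positivity) hE
  obtain ⟨E', hsub, hhalf, hmax, havg⟩ := exists_subset_degree_bounds hF ht E (by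
    exact (mul_le_mul_of_nonneg_right hc8 hw0.le).trans hE.le)
  refine SimpleGraph.IsContained.trans ?_
    (ffDistanceGraph_isContained_of_subset (Finset.coe_subset.mpr hsub) t)
  have hcard : (Fintype.card (E' : Set (Fin d → F)) : ℝ) = E'.card := by
    simp
  have hn'0 : (0 : ℝ) < E'.card := by
    change n ≤ _ at hhalf
    linarith
  have hn'n : (E'.card : ℝ) ≤ n := Nat.cast_le.mpr (Finset.card_le_card hsub)
  refine SimpleGraph.cycleGraph_isContained_of_degree hk (D := 4 * n / q) (d := n / (4 * q))
    (by positivity) (by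
      rw [← Nat.cast_pos (α := ℝ), hcard]; exact hn'0) ?_ ?_ ?_
  · intro v
    rw [degree_ffDistanceGraph E' ht, le_div_iff₀ hq0, mul_comm]
    exact hmax v v.2
  · rw [hcard]
    simp only [degree_ffDistanceGraph E' ht]
    have h1 : ∑ v : (E' : Set (Fin d → F)),
        ((E'.filter fun y => ffLength ((v : Fin d → F) - y) = t).card : ℝ) =
        ∑ x ∈ E', ((E'.filter fun y => ffLength (x - y) = t).card : ℝ) :=
      Finset.sum_coe_sort E' (fun x => ((E'.filter fun y => ffLength (x - y) = t).card : ℝ))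
    rw [h1, div_mul_eq_mul_div, div_le_iff₀ (by positivity)]
    change n / 4 * _ ≤ _ at havg
    linarith
  · rw [hcard]
    have hwk : q ^ k ≤ w ^ (k - 1) := by
      refine le_of_sq_le_sq ?_ (by positivity)
      calc (q ^ k) ^ 2 = q ^ (2 * k) := by rw [← pow_mul, mul_comm]
        _ ≤ q ^ ((d + 1) * (k - 1)) := pow_le_pow_right₀ hq1 hdk
        _ = (w ^ (k - 1)) ^ 2 := by
          rw [← Real.sq_sqrt hq0.le, hw]; ring
    -- This is the cycle criterion after substitution: 4k² · 4n/q against (n/4q)² leaves the factor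
    -- 4 · 4 · 16 = 256.
    have hnk : (256 * (k : ℝ) ^ 2) ^ k * q ^ k < n ^ (k - 1) := by
      calc c * q ^ k ≤ c ^ (k - 1) * w ^ (k - 1) :=
            mul_le_mul (le_self_pow₀ (by linarith) (by omega)) hwk (by positivity) (by positivity)
        _ = (c * w) ^ (k - 1) := (mul_pow _ _ _).symm
        _ < n ^ (k - 1) := pow_lt_pow_left₀ hE (by positivity) (by omega)
    calc (4 * (k : ℝ) ^ 2 * (4 * n / q)) ^ k * E'.card
        ≤ (4 * (k : ℝ) ^ 2 * (4 * n / q)) ^ k * n :=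
          mul_le_mul_of_nonneg_left hn'n (by positivity)
      _ = ((256 * (k : ℝ) ^ 2) ^ k * q ^ k) * (n ^ k * n / (16 * q ^ 2) ^ k) := by
          rw [← mul_pow, mul_div_right_comm (n ^ k), ← mul_assoc, ← div_pow, ← mul_pow]
          congr 2
          field_simp
          ring
      _ < n ^ (k - 1) * (n ^ k * n / (16 * q ^ 2) ^ k) :=
          mul_lt_mul_of_pos_right hnk (by positivity)
      _ = (n / (4 * q)) ^ (2 * k) := by
          rw [div_pow, pow_mul (4 * q), mul_div_assoc']
          congr 1
          · rw [mul_comm (n ^ k) n, ← mul_assoc, ← pow_succ, Nat.sub_add_cancel (by omega),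
              ← pow_add, two_mul]
          · congr 1
            ring

end DistanceGraph

theorem corollary1p6 :
    ∀ k : ℕ, 2 ≤ k → ∃ c : ℝ, 0 < c ∧
      ∀ (F : Type*) [Field F] [Fintype F], ringChar F ≠ 2 →
        ∀ (d : ℕ) (E : Set (Fin d → F)),
          c * (Fintype.card F : ℝ) ^ (((d : ℝ) + 1) / 2) < (E.ncard : ℝ) →
            (d = 2 → 3 ≤ k →
              Set.univ \ {0} ⊆ ffGraphDistanceSet (SimpleGraph.cycleGraph (2 * k)) E) ∧
            (3 ≤ d →
              Set.univ \ {0} ⊆ ffGraphDistanceSet (SimpleGraph.cycleGraph (2 * k)) E) := by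
  intro k hk
  refine ⟨(256 * (k : ℝ) ^ 2) ^ k, ?_, ?_⟩
  · have : (0 : ℝ) < k := by exact_mod_cast (by omega : 0 < k)
    positivity
  intro F _ _ hF d E hE
  classical
  have hpow : (Fintype.card F : ℝ) ^ (((d : ℝ) + 1) / 2) = √(Fintype.card F) ^ (d + 1) := by
    rw [Real.sqrt_eq_rpow, ← Real.rpow_natCast, ← Real.rpow_mul (Nat.cast_nonneg _)]
    congr 1
    push_cast
    ring
  rw [hpow, Set.ncard_eq_toFinset_card'] at hE
  have key : 2 * k ≤ (d + 1) * (k - 1) →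
      Set.univ \ {0} ⊆ ffGraphDistanceSet (SimpleGraph.cycleGraph (2 * k)) E := by
    intro hdk t ht
    have := cycleGraph_isContained_ffDistanceGraph hk hF hdk (t := t) (fun h => ht.2 h)
      E.toFinset hE
    rwa [Set.coe_toFinset] at this
  -- The exponent condition is 2k ≤ 3(k - 1), that is k ≥ 3, in the plane; in higher dimension it
  -- follows from 2k ≤ 4(k - 1), valid for k ≥ 2.
  obtain ⟨l, rfl⟩ : ∃ l, k = l + 2 := ⟨k - 2, by omega⟩
  refine ⟨fun hd hk3 => key ?_, fun hd => key ?_⟩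
  · subst hd
    omega
  · have : 4 * (l + 2 - 1) ≤ (d + 1) * (l + 2 - 1) := Nat.mul_le_mul_right _ (by omega)
    omega
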